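/- Let $\mathcal S,\mathcal A$ be finite sets with $|\mathcal S|,|\mathcal A|>1$, $\gamma\in(0,1)$, $\nu_0\in\Delta_{\mathcal S}$, and let $h:\mathcal X\to\mathbb R$ be strictly convex on a closed convex set $\mathcal X\subseteq\mathbb R^{\mathcal A}$ with $\operatorname{relint}\Delta_{\mathcal A}\subseteq\operatorname{int}\mathcal X$. For a transition law $P\in\Delta_{\mathcal S}^{\mathcal S\times\mathcal A}$ let $\mathcal M_P=\{\mu\in\mathbb R_{\ge0}^{\mathcal S\times\mathcal A}:(E-\gamma P)^\top\mu=(1-\gamma)\nu_0\}$ be the set of occupancy measures, where $(Ef)(s,a)=f(s)$ and $(Pf)(s,a)=\sum_{s'}P(s'|s,a)f(s')$, and let $\mathcal U_P=\operatorname{im}(E-\gamma P)$. With $\pi^\mu(a|s)=\mu(s,a)/\sum_{a'}\mu(s,a')$ (uniform in $a$ if the denominator is $0$), put $\bar h(\mu)=\sum_{s,a}\mu(s,a)\,h(\pi^\mu(\cdot|s))$, $J(r,\mu)=\langle r,\mu\rangle-\bar h(\mu)$, $f_P^*(r)=\max_{\mu\in\mathcal M_P}J(r,\mu)$, $\mathsf{RL}_P(r)=\arg\max_{\mu\in\mathcal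 M_P}J(r,\mu)$ and $\mathsf{SubOpt}_P(r,\mu)=f_P^*(r)-J(r,\mu)$. Let $\eta>0$. Assume steepness: $h$ is differentiable in $\operatorname{int}\mathcal X$, and $\|\nabla h(p_l)\|_2\to\infty$ whenever $(p_l)$ is a sequence in $\operatorname{int}\mathcal X$ that converges to a point of the relative boundary of $\Delta_{\mathcal A}$. Consider transition laws $P$ satisfying the following two conditions. (i) Exploration: there is $\nu_{\min}>0$ with $\sum_a\mu(s,a)\ge\nu_{\min}$ for all $s\in\mathcal S$, $\mu\in\mathcal M_P$. (ii) Regularity: $\bar h(\mu')\ge\bar h(\mu)+\langle\nabla\bar h(\mu),\mu'-\mu\rangle+\frac\eta2\|\mu'-\mu\|_2^2$ for all $\mu\in\operatorname{relint}\mathcal M_P$, $\mu'\in\mathcal M_P$, and $\nabla\bar h$ is Lipschitz continuous on every closed convex subset of $\operatorname{relint}\mathcal M_P$. Let $P^0$ be a transition law satisfying (i) and (ii), and let $\mathcal R\subset\mathbb R^{\mathcal S\times\mathcal A}$ be compact. Call $\sigma>0$ a dual strong convexity constant for $\mathcal R$ (under $P^0$) if for all $r,r'\in\mathcal R$ $$f_{P^0}^*(r')\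 \ge\ f_{P^0}^*(r)+\langle\nabla f_{P^0}^*(r),r'-r\rangle+\tfrac{\sigma}{2}\,\|[r']_{\mathcal U_{P^0}}-[r]_{\mathcal U_{P^0}}\|_2^2 ,$$ where $\|[r]_{\mathcal V}\|_2=\min_{v\in\mathcal V}\|r+v\|_2$ is the quotient norm on $\mathbb R^{\mathcal S\times\mathcal A}/\mathcal V$. Then a dual strong convexity constant exists, and for every such constant $\sigma_{\mathcal R}$ the following holds. Let $r^{\mathsf E},\hat r\in\mathcal R$, let $\mu^{\mathsf E}\in\mathsf{RL}_{P^0}(r^{\mathsf E})$ be an expert that is optimal for $r^{\mathsf E}$ under $P^0$, and suppose $\mathsf{SubOpt}_{P^0}(\hat r,\mu^{\mathsf E})\le\hat\varepsilon$. Then for every transition law $P$ satisfying (i) and (ii), $\hat r$ is $\varepsilon_P$-transferable to $P$, that is, $\mathsf{RL}_P(\hat r)$ consists of exactly one occupancy measure and $$\mathsf{SubOpt}_P\big(r^{\mathsf E},\mathsf{RL}_P(\hat r)\big)\le\varepsilon_P=\frac{2\max\{2\hat\varepsilon/\sigma_{\mathcal R},\ D^2\sin(\theta_{\max}(P^0,P))^2\}}{\eta},$$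 where $D=\max_{r,r'\in\mathcal R}\|r-r'\|_2$ and $\theta_{\max}(P^0,P)$ is the largest principal angle between the subspaces $\mathcal U_{P^0}$ and $\mathcal U_P$. -/

import Mathlib

open Filter Topology

noncomputable section

namespace IRL

/-- Transition laws `P(s' | s, a)`: one probability vector on `S` for every pair `(s, a)`. -/
structure TransitionLaw (S A : Type*) [Fintype S] where
  prob : S → A → S → ℝ
  nonneg : ∀ s a s', 0 ≤ prob s a s'
  sum_eq_one : ∀ s a, ∑ s', prob s a s' = 1

/-- The probability simplex over a finite set, as a subset of Euclidean space. -/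
def simplex (A : Type*) [Fintype A] : Set (EuclideanSpace ℝ A) :=
  {p | (∀ a, 0 ≤ p a) ∧ ∑ a, p a = 1}

/-- The data of a regularized MDP with state space `S` and action space `A`, apart from the
transition law and the reward: discount factor `γ`, initial distribution `ν₀`, and a strictly convex
regularizer `h` on a closed convex set `X` with `relint Δ_A ⊆ int X`.
(Values of `h` outside `X` are irrelevant.) -/
structure RegMDP (S A : Type*) [Fintype S] [Fintype A] where
  γ : ℝ
  γ_pos : 0 < γ
  γ_lt_one : γ < 1
  ν₀ : S → ℝ
  ν₀_nonneg : ∀ s, 0 ≤ ν₀ s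
  ν₀_sum : ∑ s, ν₀ s = 1
  X : Set (EuclideanSpace ℝ A)
  X_closed : IsClosed X
  X_convex : Convex ℝ X
  simplex_subset : intrinsicInterior ℝ (simplex A) ⊆ interior X
  h : EuclideanSpace ℝ A → ℝ
  h_strictConvex : StrictConvexOn ℝ X h

section Operators

variable {S A : Type*} [Fintype S] [Fintype A]

/-- `(E f)(s,a) = f(s)`. -/
def opE (S A : Type*) [Fintype S] [Fintype A] : (S → ℝ) →ₗ[ℝ] EuclideanSpace ℝ (S × A) where
  toFun f := WithLp.toLp 2 fun sa => f sa.1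
  map_add' f g := by ext sa; simp
  map_smul' c f := by ext sa; simp

/-- `(P f)(s,a) = ∑_{s'} P(s' | s,a) f(s')`. -/
def opP (P : TransitionLaw S A) : (S → ℝ) →ₗ[ℝ] EuclideanSpace ℝ (S × A) where
  toFun f := WithLp.toLp 2 fun sa => ∑ s', P.prob sa.1 sa.2 s' * f s'
  map_add' f g := by ext sa; simp [mul_add, Finset.sum_add_distrib]
  map_smul' c f := by
    ext sa
    simp only [Pi.smul_apply, smul_eq_mul, RingHom.id_apply, PiLp.smul_apply, Finset.mul_sum]
    exact Finset.sum_congr rfl fun _ _ => by ring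

/-- State marginal `ν(s) = ∑_a μ(s,a)`. -/
def stateMarginal (μ : EuclideanSpace ℝ (S × A)) (s : S) : ℝ := ∑ a, μ (s, a)

/-- The policy `π^μ(· | s)` corresponding to `μ` (uniform where `ν(s)` is not positive). -/
def policy (μ : EuclideanSpace ℝ (S × A)) (s : S) : EuclideanSpace ℝ A :=
  WithLp.toLp 2 fun a =>
    if 0 < stateMarginal μ s then μ (s, a) / stateMarginal μ s else 1 / (Fintype.card A : ℝ)

end Operators

section PrincipalAngles

variable {V : Type*} [NormedAddCommGroup V] [InnerProductSpace ℝ V]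

/-- The pairs `(x, y)` admissible in step `i` of the recursion for principal angles between `U` and
`W`: unit vectors of `U` and `W` orthogonal to the previously chosen ones. -/
def principalFeasible (U W : Submodule ℝ V) (v w : ℕ → V) (i : ℕ) : Set (V × V) :=
  {xy | xy.1 ∈ U ∧ xy.2 ∈ W ∧ ‖xy.1‖ = 1 ∧ ‖xy.2‖ = 1 ∧
    ∀ j < i, inner ℝ xy.1 (v j) = 0 ∧ inner ℝ xy.2 (w j) = 0}

/-- `(v 0, w 0), (v 1, w 1), …` are principal vectors of `U` and `W`: each pair maximizes the inner
product among the pairs that are admissible given the previous ones. -/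
def IsPrincipalVectors (U W : Submodule ℝ V) (v w : ℕ → V) : Prop :=
  ∀ i < Module.finrank ℝ U, (v i, w i) ∈ principalFeasible U W v w i ∧
    ∀ xy ∈ principalFeasible U W v w i, inner ℝ xy.1 xy.2 ≤ inner ℝ (v i) (w i)

/-- A choice of principal vectors. -/
def principalVectors (U W : Submodule ℝ V) : (ℕ → V) × (ℕ → V) :=
  Classical.epsilon fun vw : (ℕ → V) × (ℕ → V) => IsPrincipalVectors U W vw.1 vw.2

/-- The principal angles, counted from `0`, of two subspaces of the same finite dimension `m`;
meaningful for indices below `m`. -/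
def principalAngle (U W : Submodule ℝ V) (i : ℕ) : ℝ :=
  Real.arccos (inner ℝ ((principalVectors U W).1 i) ((principalVectors U W).2 i))

/-- The maximal principal angle, i.e. the last one. -/
def maxPrincipalAngle (U W : Submodule ℝ V) : ℝ :=
  principalAngle U W (Module.finrank ℝ U - 1)

end PrincipalAngles

namespace RegMDP

variable {S A : Type*} [Fintype S] [Fintype A] (D : RegMDP S A) (P : TransitionLaw S A)

/-- The occupancy measures, given by the Bellman flow constraints
`μ ≥ 0`, `(E - γ P)ᵀ μ = (1 - γ) ν₀`. -/
def occ : Set (EuclideanSpace ℝ (S × A)) :=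
  {μ | (∀ sa, 0 ≤ μ sa) ∧
    ∀ s', ∑ a, μ (s', a) - D.γ * ∑ s, ∑ a, P.prob s a s' * μ (s, a) = (1 - D.γ) * D.ν₀ s'}

/-- The potential shaping subspace `im (E - γ P)`. -/
def shaping : Submodule ℝ (EuclideanSpace ℝ (S × A)) :=
  LinearMap.range (opE S A - D.γ • opP P)

/-- `h̄(μ) = E_{(s,a) ∼ μ} [h(π^μ(· | s))]`. -/
def hbar (μ : EuclideanSpace ℝ (S × A)) : ℝ :=
  ∑ s, ∑ a, μ (s, a) * D.h (policy μ s)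

/-- The regularized objective `J(r, μ) = ⟨r, μ⟩ - h̄(μ)`. -/
def J (r μ : EuclideanSpace ℝ (S × A)) : ℝ := inner ℝ r μ - D.hbar μ

/-- The optimal value `max_{μ ∈ M_P} J(r, μ)`; as a function of `r` this is the convex conjugate of
`h̄` restricted to the occupancy measures. -/
def optValue (r : EuclideanSpace ℝ (S × A)) : ℝ := sSup (D.J r '' D.occ P)

/-- The set of maximizers `argmax_{μ ∈ M_P} J(r, μ)`. -/
def RL (r : EuclideanSpace ℝ (S × A)) : Set (EuclideanSpace ℝ (S × A)) :=
  {μ | μ ∈ D.occ P ∧ ∀ μ' ∈ D.occ P, D.J r μ' ≤ D.J r μ}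

/-- The suboptimality of `μ` for the reward `r` under `P`. -/
def SubOpt (r μ : EuclideanSpace ℝ (S × A)) : ℝ := D.optValue P r - D.J r μ

/-- `rhat` is `ε`-transferable to the set `Ps` of transition laws, for the expert reward `rE`: under
each `P` in `Ps` there is exactly one optimal occupancy measure for `rhat`, and it is `ε`-optimal
for `rE`. -/
def IsTransferable (rE rhat : EuclideanSpace ℝ (S × A)) (ε : ℝ) (Ps : Set (TransitionLaw S A)) :
    Prop :=
  ∀ P ∈ Ps, ∃ μ, D.RL P rhat = {μ} ∧ D.SubOpt P rE μ ≤ ε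

/-- Steep regularization. -/
def Steep : Prop :=
  (∀ p ∈ interior D.X, DifferentiableAt ℝ D.h p) ∧
  ∀ (p : ℕ → EuclideanSpace ℝ A) (q : EuclideanSpace ℝ A),
    (∀ l, p l ∈ interior D.X) → q ∈ intrinsicFrontier ℝ (simplex A) →
    Tendsto p atTop (𝓝 q) → Tendsto (fun l => ‖gradient D.h (p l)‖) atTop atTop

/-- Exploration: the state marginals of occupancy measures are uniformly bounded below. -/
def Exploration : Prop :=
  ∃ νmin : ℝ, 0 < νmin ∧ ∀ μ ∈ D.occ P, ∀ s, νmin ≤ stateMarginal μ s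

/-- `h̄` is `η`-strongly convex over the occupancy measures. The base point `μ` ranges over the
relative interior: a steep regularizer has no gradient on the relative boundary. -/
def StronglyConvex (η : ℝ) : Prop :=
  ∀ μ ∈ intrinsicInterior ℝ (D.occ P), ∀ μ' ∈ D.occ P,
    D.hbar μ + inner ℝ (gradient D.hbar μ) (μ' - μ) + η / 2 * ‖μ' - μ‖ ^ 2 ≤ D.hbar μ'

/-- The gradient of `h̄` is locally Lipschitz over the relative interior of the occupancy
measures. -/
def LocallyLipschitzGradient : Prop :=
  ∀ K ⊆ intrinsicInterior ℝ (D.occ P), IsClosed K → Convex ℝ K →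
    ∃ L : ℝ, 0 < L ∧ ∀ μ ∈ K, ∀ μ' ∈ K,
      ‖gradient D.hbar μ - gradient D.hbar μ'‖ ≤ L * ‖μ - μ'‖

/-- Regularity of the regularizer over the occupancy measures, with constant `η`. -/
def Regularity (η : ℝ) : Prop :=
  D.StronglyConvex P η ∧ D.LocallyLipschitzGradient P

/-- `σ` is a dual strong convexity constant on the reward class `R`: the conjugate `optValue` is
`σ`-strongly convex on `R` with respect to the quotient norm modulo potential shaping. -/
def IsDualStrongConvexityConstant (R : Set (EuclideanSpace ℝ (S × A))) (σ : ℝ) : Prop :=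
  0 < σ ∧ ∀ r ∈ R, ∀ r' ∈ R,
    D.optValue P r + inner ℝ (gradient (D.optValue P) r) (r' - r)
      + σ / 2 * ‖(D.shaping P).mkQ r' - (D.shaping P).mkQ r‖ ^ 2 ≤ D.optValue P r'

/-- The maximal principal angle between two transition laws. -/
def θmax (P P' : TransitionLaw S A) : ℝ := maxPrincipalAngle (D.shaping P) (D.shaping P')

end RegMDP

end IRL

end

noncomputable section

namespace IRL

/-! ### Quotient norms in an inner product space. -/

section QuotientNorm

variable {V : Type*} [NormedAddCommGroup V] [InnerProductSpace ℝ V]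

/-! Differences of occupancy measures lie in the orthogonal complement of the shaping subspace,
because the flow operator is the adjoint of `E - γP`. A reward therefore matters only through its
projection to that complement, whose norm is the quotient norm.

Exploration and steepness keep optima off the boundary, so the optimum for any reward is a positive
measure at which the gradient of `hbar` agrees with the reward along all feasible directions
(`exists_isInteriorOptimum`). Together with strong convexity this gives uniqueness, quadratic growth
of the loss, an optimum that is Lipschitz in the reward, and the optimum as gradient of the optimal
value.

A dual constant exists because, on a compact reward class, optima keep a uniform distance from the
boundary: a small step along the projected reward change stays where `gradient D.hbar` is Lipschitz
and gains a multiple of the squared quotient norm.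

For the transfer bound, the suboptimality of the expert for the learned reward is a Bregman
divergence of the optimal value, so the dual constant turns it into closeness of the two rewards
modulo shaping under the source law. Passing to the shaping subspace of the target law costs at most
the sine of the largest principal angle times the norm of the difference
(`norm_mkQ_le_add_sin_maxPrincipalAngle`). Finally, quadratic growth converts closeness modulo
shaping back into suboptimality (`IsInteriorOptimum.subOpt_le`). -/

theorem norm_mkQ_eq_norm_starProjection_orthogonal (U : Submodule ℝ V)
    [U.HasOrthogonalProjection] (x : V) : ‖U.mkQ x‖ = ‖Uᗮ.starProjection x‖ := by
  apply le_antisymm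
  · have h : U.mkQ x = U.mkQ (Uᗮ.starProjection x) := by
      rw [Submodule.mkQ_apply, Submodule.mkQ_apply, Submodule.Quotient.eq]
      have := U.starProjection_add_starProjection_orthogonal x
      have h2 : x - Uᗮ.starProjection x = U.starProjection x := by
        rw [sub_eq_iff_eq_add]; exact this.symm
      rw [h2]
      exact U.starProjection_apply_mem x
    rw [h]
    exact Submodule.Quotient.norm_mk_le U _
  -- An almost shortest representative differs from `x` by an element of `U`, which the projection
  -- to `Uᗮ` kills.
  · refine le_of_forall_pos_le_add fun ε hε => ?_
    obtain ⟨m, hm, hlt⟩ := Submodule.Quotient.norm_mk_lt (S := U) (U.mkQ x) hε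
    have h : m - x ∈ U := by
      rw [← Submodule.Quotient.eq]; exact hm
    have h0 : Uᗮ.starProjection (m - x) = 0 :=
      (Submodule.starProjection_apply_eq_zero_iff (K := Uᗮ)).2
        (U.le_orthogonal_orthogonal h)
    have h1 : Uᗮ.starProjection x = Uᗮ.starProjection m := by
      rw [map_sub, sub_eq_zero] at h0
      exact h0.symm
    rw [h1]
    exact (Uᗮ.norm_starProjection_apply_le m).trans hlt.le

end QuotientNorm

/-! ### Principal angles and the distance between subspaces. -/

section PrincipalAngles

variable {V : Type*} [NormedAddCommGroup V] [InnerProductSpace ℝ V]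

theorem principalFeasible_congr (U W : Submodule ℝ V) {v w v' w' : ℕ → V} {i : ℕ}
    (h : ∀ j < i, v j = v' j ∧ w j = w' j) :
    principalFeasible U W v w i = principalFeasible U W v' w' i := by
  ext xy
  simp only [principalFeasible, Set.mem_ofPred_eq]
  refine and_congr_right fun _ => and_congr_right fun _ => and_congr_right fun _ =>
    and_congr_right fun _ => forall_congr' fun j => forall_congr' fun hj => ?_
  rw [(h j hj).1, (h j hj).2]

namespace IsPrincipalVectors

variable {U W : Submodule ℝ V} {v w : ℕ → V}

theorem symm (h : IsPrincipalVectors U W v w)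
    (hUW : Module.finrank ℝ U = Module.finrank ℝ W) : IsPrincipalVectors W U w v := by
  intro i hi
  obtain ⟨⟨h1, h2, h3, h4, h5⟩, hmax⟩ := h i (hUW ▸ hi)
  refine ⟨⟨h2, h1, h4, h3, fun j hj => (h5 j hj).symm⟩, ?_⟩
  rintro ⟨x, y⟩ ⟨g1, g2, g3, g4, g5⟩
  rw [real_inner_comm (v i) (w i), real_inner_comm y x]
  exact hmax (y, x) ⟨g2, g1, g4, g3, fun j hj => (g5 j hj).symm⟩

theorem inner_le_mul_norm (h : IsPrincipalVectors U W v w) {j : ℕ}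
    (hj : j < Module.finrank ℝ U) {x : V} (hx : x ∈ U) (hxo : ∀ l < j, inner ℝ x (v l) = 0) :
    inner ℝ x (w j) ≤ inner ℝ (v j) (w j) * ‖x‖ := by
  obtain ⟨⟨h1, h2, h3, h4, h5⟩, hmax⟩ := h j hj
  rcases eq_or_ne x 0 with rfl | hx0
  · simp
  have hn : 0 < ‖x‖ := norm_pos_iff.2 hx0
  have := hmax ((‖x‖⁻¹ : ℝ) • x, w j) ⟨U.smul_mem _ hx, h2, by
    rw [norm_smul, norm_inv, norm_norm, inv_mul_cancel₀ hn.ne'], h4, fun l hl =>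
      ⟨by rw [inner_smul_left, hxo l hl, mul_zero], (h5 l hl).2⟩⟩
  simp only [inner_smul_left, conj_trivial] at this
  rw [inv_mul_le_iff₀ hn] at this
  linarith

theorem inner_nonneg (h : IsPrincipalVectors U W v w) {j : ℕ}
    (hj : j < Module.finrank ℝ U) : 0 ≤ (inner ℝ (v j) (w j) : ℝ) := by
  obtain ⟨⟨h1, h2, h3, h4, h5⟩, hmax⟩ := h j hj
  have := h.inner_le_mul_norm hj (U.neg_mem h1) (fun l hl => by
    rw [inner_neg_left, (h5 l hl).1, neg_zero])
  rw [norm_neg, h3, inner_neg_left] at this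
  linarith

/-- Vectors of `U` that are orthogonal to the first principal vectors of `U` are orthogonal to the
corresponding principal vectors of `W`. -/
theorem inner_eq_zero (h : IsPrincipalVectors U W v w) {j : ℕ}
    (hj : j < Module.finrank ℝ U) {x : V} (hx : x ∈ U) (hxo : ∀ l ≤ j, inner ℝ x (v l) = 0) :
    inner ℝ x (w j) = 0 := by
  obtain ⟨⟨h1, h2, h3, h4, h5⟩, hmax⟩ := h j hj
  set c : ℝ := inner ℝ (v j) (w j) with hc
  have hc0 : 0 ≤ c := h.inner_nonneg hj
  set a : ℝ := inner ℝ x (w j) with ha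
  -- First variation: `v j + t • x` competes in step `j`. Its norm changes only to second order in
  -- `t`, so the linear term `t * a` has to vanish.
  have key : ∀ t : ℝ, (c + t * a) ≤ c * ‖v j + t • x‖ := by
    intro t
    have := h.inner_le_mul_norm hj (U.add_mem h1 (U.smul_mem t hx)) (fun l hl => by
      rw [inner_add_left, (h5 l hl).1, inner_smul_left, hxo l hl.le]; simp)
    rwa [inner_add_left, inner_smul_left] at this
  have hnorm : ∀ t : ℝ, ‖v j + t • x‖ ^ 2 = 1 + t ^ 2 * ‖x‖ ^ 2 := by
    intro t
    rw [norm_add_sq_real, h3, inner_smul_right, real_inner_comm, hxo j le_rfl, norm_smul, mul_pow,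
      Real.norm_eq_abs, sq_abs]
    ring
  by_contra hne
  have hbound : ∀ t : ℝ, 2 * (t * a) ≤ c * (t ^ 2 * ‖x‖ ^ 2) := by
    intro t
    have h1 := key t
    have h2 : ‖v j + t • x‖ ≤ 1 + t ^ 2 * ‖x‖ ^ 2 / 2 := by
      have := hnorm t
      nlinarith [sq_nonneg (‖v j + t • x‖ - 1)]
    nlinarith [mul_le_mul_of_nonneg_left h2 hc0]
  have hp : 0 < c * ‖x‖ ^ 2 + 1 := by positivity
  have := hbound (a / (c * ‖x‖ ^ 2 + 1))
  have ha2 : 0 < a ^ 2 := by positivity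
  have e1 : 2 * (a / (c * ‖x‖ ^ 2 + 1) * a) = 2 * a ^ 2 / (c * ‖x‖ ^ 2 + 1) := by ring
  have e2 : c * ((a / (c * ‖x‖ ^ 2 + 1)) ^ 2 * ‖x‖ ^ 2)
      = a ^ 2 * (c * ‖x‖ ^ 2) / (c * ‖x‖ ^ 2 + 1) ^ 2 := by
    rw [div_pow]; ring
  rw [e1, e2, div_le_div_iff₀ hp (by positivity)] at this
  nlinarith [mul_pos ha2 hp, mul_nonneg hc0 (sq_nonneg ‖x‖)]

/-- The two families are biorthogonal, as in a singular value decomposition. The previous lemma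
covers one order of the indices; exchanging the subspaces, which needs equal dimensions, covers the
other. -/
theorem inner_eq_zero_of_ne (h : IsPrincipalVectors U W v w)
    (hUW : Module.finrank ℝ U = Module.finrank ℝ W) {i j : ℕ} (hi : i < Module.finrank ℝ U)
    (hj : j < Module.finrank ℝ U) (hij : i ≠ j) : inner ℝ (v i) (w j) = 0 := by
  rcases hij.lt_or_gt with hlt | hlt
  · rw [real_inner_comm]
    obtain ⟨⟨h1, h2, h3, h4, h5⟩, -⟩ := h j hj
    exact (h.symm hUW).inner_eq_zero (hUW ▸ hi) h2 fun l hl => (h5 l (hl.trans_lt hlt)).2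
  · obtain ⟨⟨h1, h2, h3, h4, h5⟩, -⟩ := h i hi
    exact h.inner_eq_zero hj h1 fun l hl => (h5 l (hl.trans_lt hlt)).1

theorem orthonormal_left (h : IsPrincipalVectors U W v w) :
    Orthonormal ℝ fun i : Fin (Module.finrank ℝ U) => v i := by
  refine ⟨fun i => (h i i.2).1.2.2.1, fun i j hij => ?_⟩
  rcases lt_or_gt_of_ne (Fin.val_ne_of_ne hij) with hlt | hlt
  · change inner ℝ (v i) (v j) = 0
    rw [real_inner_comm]
    exact ((h j j.2).1.2.2.2.2 i hlt).1
  · exact ((h i i.2).1.2.2.2.2 j hlt).1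

theorem inner_antitone (h : IsPrincipalVectors U W v w) {i j : ℕ} (hij : i ≤ j)
    (hj : j < Module.finrank ℝ U) : (inner ℝ (v j) (w j) : ℝ) ≤ inner ℝ (v i) (w i) := by
  obtain ⟨⟨h1, h2, h3, h4, h5⟩, -⟩ := h j hj
  exact (h i (hij.trans_lt hj)).2 (v j, w j) ⟨h1, h2, h3, h4, fun l hl => h5 l (hl.trans_le hij)⟩

/-- In principal coordinates, with `u = ∑ aᵢ vᵢ` and cosines `cᵢ`, the choice `y = ∑ aᵢ cᵢ wᵢ` gives
squared distance `∑ aᵢ² (1 - cᵢ²)`, and the last cosine is the smallest. -/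
theorem exists_norm_sub_sq_le [FiniteDimensional ℝ U] (h : IsPrincipalVectors U W v w)
    (hUW : Module.finrank ℝ U = Module.finrank ℝ W) {u : V} (hu : u ∈ U) :
    ∃ y ∈ W, ‖u - y‖ ^ 2 ≤
      (1 - (inner ℝ (v (Module.finrank ℝ U - 1)) (w (Module.finrank ℝ U - 1)) : ℝ) ^ 2)
        * ‖u‖ ^ 2 := by
  set m := Module.finrank ℝ U with hm
  set c : ℝ := inner ℝ (v (m - 1)) (w (m - 1)) with hc
  have hv := h.orthonormal_left
  have hw : Orthonormal ℝ fun i : Fin m => w i := by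
    have := (h.symm hUW).orthonormal_left
    rw [← hUW] at this
    exact this
  have hspan : Submodule.span ℝ (Set.range fun i : Fin m => v i) = U := by
    apply Submodule.eq_of_le_of_finrank_eq
    · rw [Submodule.span_le]
      rintro _ ⟨i, rfl⟩
      exact (h i i.2).1.1
    · rw [finrank_span_eq_card hv.linearIndependent, Fintype.card_fin]
  rw [← hspan, Submodule.mem_span_range_iff_exists_fun] at hu
  obtain ⟨a, rfl⟩ := hu
  refine ⟨∑ i : Fin m, (a i * inner ℝ (v i) (w i)) • w i, W.sum_mem fun i _ =>
    W.smul_mem _ (h i i.2).1.2.1, ?_⟩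
  have e1 : ‖∑ i : Fin m, a i • v i‖ ^ 2 = ∑ i, a i ^ 2 := by
    rw [← real_inner_self_eq_norm_sq, hv.inner_sum]
    exact Finset.sum_congr rfl fun i _ => by rw [conj_trivial, sq]
  have e2 : ‖∑ i : Fin m, (a i * inner ℝ (v i) (w i)) • w i‖ ^ 2
      = ∑ i : Fin m, (a i * inner ℝ (v i) (w i)) ^ 2 := by
    rw [← real_inner_self_eq_norm_sq, hw.inner_sum]
    simp only [conj_trivial, sq]
  have e3 : inner ℝ (∑ i : Fin m, a i • v i) (∑ i : Fin m, (a i * inner ℝ (v i) (w i)) • w i)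
      = ∑ i : Fin m, (a i * inner ℝ (v i) (w i)) ^ 2 := by
    rw [sum_inner]
    refine Finset.sum_congr rfl fun i _ => ?_
    rw [inner_sum, Finset.sum_eq_single i]
    · rw [inner_smul_left, inner_smul_right]
      simp only [conj_trivial]
      ring
    · intro j _ hji
      rw [inner_smul_left, inner_smul_right,
        h.inner_eq_zero_of_ne hUW i.2 j.2 (Fin.val_ne_of_ne hji.symm)]
      simp
    · simp
  rw [norm_sub_sq_real, e1, e2, e3]
  have hle : c ^ 2 * ∑ i : Fin m, a i ^ 2 ≤ ∑ i : Fin m, (a i * inner ℝ (v i) (w i)) ^ 2 := by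
    rw [Finset.mul_sum]
    refine Finset.sum_le_sum fun i _ => ?_
    have hi : (i : ℕ) < m := i.2
    have hlt : m - 1 < m := by omega
    have h1 : c ≤ inner ℝ (v i) (w i) := h.inner_antitone (by omega) hlt
    have h0 : 0 ≤ c := h.inner_nonneg hlt
    rw [mul_pow, mul_comm]
    exact mul_le_mul_of_nonneg_left (pow_le_pow_left₀ h0 h1 2) (sq_nonneg _)
  linarith

end IsPrincipalVectors

variable [FiniteDimensional ℝ V]

theorem exists_unit_mem_orthogonal_of_lt_finrank (U : Submodule ℝ V) (v : ℕ → V) {i : ℕ}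
    (hi : i < Module.finrank ℝ U) :
    ∃ x ∈ U, ‖x‖ = 1 ∧ ∀ j < i, inner ℝ x (v j) = 0 := by
  let L : U →ₗ[ℝ] (Fin i → ℝ) :=
    LinearMap.pi fun j => (innerₛₗ ℝ (v j)).comp U.subtype
  have hker : L.ker ≠ ⊥ := by
    apply LinearMap.ker_ne_bot_of_finrank_lt
    simpa using hi
  obtain ⟨x, hx, hx0⟩ := Submodule.exists_mem_ne_zero_of_ne_bot hker
  have hx0' : (x : V) ≠ 0 := by simpa using hx0
  have horth : ∀ j < i, inner ℝ (x : V) (v j) = 0 := by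
    intro j hj
    have := congrFun (LinearMap.mem_ker.1 hx) ⟨j, hj⟩
    rw [real_inner_comm]
    simpa [L] using this
  refine ⟨(‖(x : V)‖⁻¹ : ℝ) • (x : V), U.smul_mem _ x.2, ?_, fun j hj => ?_⟩
  · rw [norm_smul, norm_inv, norm_norm, inv_mul_cancel₀ (norm_ne_zero_iff.2 hx0')]
  · rw [inner_smul_left, horth j hj, mul_zero]

theorem isCompact_principalFeasible (U W : Submodule ℝ V) (v w : ℕ → V) (i : ℕ) :
    IsCompact (principalFeasible U W v w i) := by
  have : ProperSpace V := FiniteDimensional.proper ℝ V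
  refine ((isCompact_sphere (0 : V) 1).prod (isCompact_sphere (0 : V) 1)).of_isClosed_subset ?_ ?_
  · have hU : IsClosed (U : Set V) := U.closed_of_finiteDimensional
    have hW : IsClosed (W : Set V) := W.closed_of_finiteDimensional
    have : principalFeasible U W v w i = (Prod.fst ⁻¹' (U : Set V)) ∩ ((Prod.snd ⁻¹' (W : Set V)) ∩
        ({xy | ‖xy.1‖ = 1} ∩ ({xy | ‖xy.2‖ = 1} ∩
          ⋂ j, ⋂ (_ : j < i), ({xy | inner ℝ xy.1 (v j) = 0} ∩ {xy | inner ℝ xy.2 (w j) = 0})))) := by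
      ext xy
      simp [principalFeasible]
    rw [this]
    refine (hU.preimage continuous_fst).inter ((hW.preimage continuous_snd).inter
      ((isClosed_eq (by fun_prop) (by fun_prop)).inter
      ((isClosed_eq (by fun_prop) (by fun_prop)).inter
      (isClosed_iInter fun j => isClosed_iInter fun _ =>
        (isClosed_eq (by fun_prop) (by fun_prop)).inter
        (isClosed_eq (by fun_prop) (by fun_prop))))))
  · rintro ⟨x, y⟩ ⟨_, _, hx, hy, _⟩
    exact ⟨by simpa using hx, by simpa using hy⟩

/-- Greedy construction: each admissible set is compact, and nonempty by a dimension count. It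
depends only on earlier vectors, so updating index `k` does not disturb previous steps. Hence the
`epsilon` in `principalVectors` never takes a junk value for equal dimensions. -/
theorem exists_isPrincipalVectors (U W : Submodule ℝ V)
    (hUW : Module.finrank ℝ U = Module.finrank ℝ W) :
    ∃ v w : ℕ → V, IsPrincipalVectors U W v w := by
  suffices H : ∀ k ≤ Module.finrank ℝ U, ∃ v w : ℕ → V, ∀ i < k,
      (v i, w i) ∈ principalFeasible U W v w i ∧
      ∀ xy ∈ principalFeasible U W v w i, inner ℝ xy.1 xy.2 ≤ inner ℝ (v i) (w i) from
    H _ le_rfl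
  intro k
  induction k with
  | zero => exact fun _ => ⟨0, 0, fun i hi => absurd hi (Nat.not_lt_zero i)⟩
  | succ k ih =>
    intro hk
    obtain ⟨v, w, hvw⟩ := ih (Nat.le_of_succ_le hk)
    have hne : (principalFeasible U W v w k).Nonempty := by
      obtain ⟨x, hxU, hx1, hx⟩ := exists_unit_mem_orthogonal_of_lt_finrank U v (i := k) hk
      obtain ⟨y, hyW, hy1, hy⟩ := exists_unit_mem_orthogonal_of_lt_finrank W w (i := k) (hUW ▸ hk)
      exact ⟨(x, y), hxU, hyW, hx1, hy1, fun j hj => ⟨hx j hj, hy j hj⟩⟩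
    obtain ⟨xy, hxy, hmax⟩ := (isCompact_principalFeasible U W v w k).exists_isMaxOn hne
      (f := fun xy => inner ℝ xy.1 xy.2) (by fun_prop)
    refine ⟨Function.update v k xy.1, Function.update w k xy.2, fun i hi => ?_⟩
    have hik : i ≤ k := Nat.lt_succ_iff.1 hi
    rw [principalFeasible_congr U W (v' := v) (w' := w) (i := i) fun j hj => by
      have : j ≠ k := (hj.trans_le hik).ne
      simp [this]]
    rcases hik.lt_or_eq with hlt | rfl
    · simpa [hlt.ne] using hvw i hlt
    · simpa using And.intro hxy fun a b hab => hmax hab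

theorem isPrincipalVectors_principalVectors (U W : Submodule ℝ V)
    (hUW : Module.finrank ℝ U = Module.finrank ℝ W) :
    IsPrincipalVectors U W (principalVectors U W).1 (principalVectors U W).2 := by
  obtain ⟨v, w, h⟩ := exists_isPrincipalVectors U W hUW
  exact Classical.epsilon_spec
    (p := fun vw : (ℕ → V) × (ℕ → V) => IsPrincipalVectors U W vw.1 vw.2) ⟨(v, w), h⟩

theorem exists_norm_sub_sq_le_sin_maxPrincipalAngle (U W : Submodule ℝ V)
    (hUW : Module.finrank ℝ U = Module.finrank ℝ W) (hpos : 0 < Module.finrank ℝ U)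
    {u : V} (hu : u ∈ U) :
    ∃ y ∈ W, ‖u - y‖ ^ 2 ≤ Real.sin (maxPrincipalAngle U W) ^ 2 * ‖u‖ ^ 2 := by
  have h := isPrincipalVectors_principalVectors U W hUW
  obtain ⟨y, hy, hle⟩ := h.exists_norm_sub_sq_le hUW hu
  refine ⟨y, hy, hle.trans_eq ?_⟩
  have hlt : Module.finrank ℝ U - 1 < Module.finrank ℝ U := by omega
  have h1 := h.inner_nonneg hlt
  obtain ⟨⟨_, _, n1, n2, _⟩, -⟩ := h _ hlt
  have h2 := real_inner_le_norm ((principalVectors U W).1 (Module.finrank ℝ U - 1))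
    ((principalVectors U W).2 (Module.finrank ℝ U - 1))
  rw [n1, n2, mul_one] at h2
  rw [maxPrincipalAngle, principalAngle, Real.sin_arccos, Real.sq_sqrt (by nlinarith)]

theorem norm_mkQ_le_add_sin_maxPrincipalAngle (U W : Submodule ℝ V)
    (hUW : Module.finrank ℝ U = Module.finrank ℝ W) (hpos : 0 < Module.finrank ℝ U) (x : V) :
    ‖W.mkQ x‖ ≤ ‖U.mkQ x‖ + |Real.sin (maxPrincipalAngle U W)| * ‖x‖ := by
  obtain ⟨y, hy, hle⟩ := exists_norm_sub_sq_le_sin_maxPrincipalAngle U W hUW hpos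
    (U.starProjection_apply_mem x)
  have h1 : ‖U.starProjection x - y‖ ≤ |Real.sin (maxPrincipalAngle U W)| * ‖x‖ := by
    refine le_trans (b := |Real.sin (maxPrincipalAngle U W)| * ‖U.starProjection x‖)
      ((sq_le_sq₀ (norm_nonneg _) (by positivity)).1 ?_) ?_
    · rwa [mul_pow, sq_abs]
    · exact mul_le_mul_of_nonneg_left (U.norm_starProjection_apply_le x) (abs_nonneg _)
  -- Modulo `W`, the `U`-component of `x` may be replaced by its difference from a nearby point of
  -- `W`.
  have h2 : W.mkQ x = W.mkQ (Uᗮ.starProjection x + (U.starProjection x - y)) := by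
    rw [Submodule.mkQ_apply, Submodule.mkQ_apply, Submodule.Quotient.eq]
    have := U.starProjection_add_starProjection_orthogonal x
    have h3 : x - (Uᗮ.starProjection x + (U.starProjection x - y)) = y := by
      nth_rw 1 [← this]; abel
    rwa [h3]
  rw [h2, norm_mkQ_eq_norm_starProjection_orthogonal U x]
  exact (Submodule.Quotient.norm_mk_le W _).trans ((norm_add_le _ _).trans (by gcongr))

end PrincipalAngles

/-! ### Relative interior and boundary, in particular of the simplex. -/

theorem mem_intrinsicInterior_of_eventually {V : Type*} [NormedAddCommGroup V] [NormedSpace ℝ V]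
    {s : Set V} {x : V} (hx : x ∈ s) (h : ∀ᶠ y in 𝓝 x, y ∈ affineSpan ℝ s → y ∈ s) :
    x ∈ intrinsicInterior ℝ s := by
  refine mem_intrinsicInterior.2 ⟨⟨x, subset_affineSpan ℝ s hx⟩, ?_, rfl⟩
  rw [mem_interior_iff_mem_nhds]
  have := (continuous_subtype_val.tendsto (⟨x, subset_affineSpan ℝ s hx⟩ : affineSpan ℝ s)).eventually h
  exact this.mono fun y hy => hy y.2

theorem sub_mem_of_mem_affineSpan {V : Type*} [NormedAddCommGroup V] [NormedSpace ℝ V]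
    {s : Set V} {U : Submodule ℝ V} (h : ∀ x ∈ s, ∀ y ∈ s, x - y ∈ U) {x y : V}
    (hx : x ∈ s) (hy : y ∈ affineSpan ℝ s) : y - x ∈ U := by
  have h1 : y - x ∈ vectorSpan ℝ s := by
    rw [← direction_affineSpan]
    exact AffineSubspace.vsub_mem_direction hy (subset_affineSpan ℝ s hx)
  have h2 : vectorSpan ℝ s ≤ U := by
    rw [vectorSpan_def, Submodule.span_le]
    rintro _ ⟨a, ha, b, hb, rfl⟩
    exact h a ha b hb
  exact h2 h1

section Simplex

variable {A : Type*} [Fintype A]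

theorem mem_intrinsicInterior_simplex {p : EuclideanSpace ℝ A} (hp : p ∈ simplex A)
    (hpos : ∀ a, 0 < p a) : p ∈ intrinsicInterior ℝ (simplex A) := by
  let L : EuclideanSpace ℝ A →ₗ[ℝ] ℝ := ∑ a, EuclideanSpace.projₗ a
  have hL : ∀ x, L x = ∑ a, x a := fun x => by simp [L]
  refine mem_intrinsicInterior_of_eventually hp ?_
  have hev : ∀ᶠ y : EuclideanSpace ℝ A in 𝓝 p, ∀ a, 0 < y a :=
    eventually_all.2 fun a =>
      (show Continuous fun y : EuclideanSpace ℝ A => y a by fun_prop).tendsto p |>.eventually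
        (lt_mem_nhds (hpos a))
  filter_upwards [hev] with y hy hspan
  refine ⟨fun a => (hy a).le, ?_⟩
  have : y - p ∈ L.ker := by
    refine sub_mem_of_mem_affineSpan (fun x hx z hz => ?_) hp hspan
    rw [LinearMap.mem_ker, map_sub, hL, hL, hx.2, hz.2, sub_self]
  rw [LinearMap.mem_ker, map_sub, hL, hL, hp.2, sub_eq_zero] at this
  exact this

theorem mem_intrinsicFrontier_simplex [Nonempty A] {p : EuclideanSpace ℝ A} (hp : p ∈ simplex A)
    {a : A} (ha : p a = 0) : p ∈ intrinsicFrontier ℝ (simplex A) := by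
  rw [← intrinsicClosure_sdiff_intrinsicInterior]
  refine ⟨subset_intrinsicClosure hp, fun hint => ?_⟩
  obtain ⟨y, hy, hyp⟩ := mem_intrinsicInterior.1 hint
  let u : EuclideanSpace ℝ A := WithLp.toLp 2 fun _ => (Fintype.card A : ℝ)⁻¹
  have hcard : (0 : ℝ) < Fintype.card A := by exact_mod_cast Fintype.card_pos
  have hu : u ∈ simplex A := ⟨fun _ => by simp [u], by simp [u, hcard.ne']⟩
  have hmem : ∀ t : ℝ, AffineMap.lineMap p u t ∈ affineSpan ℝ (simplex A) := fun t =>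
    AffineMap.lineMap_mem t (subset_affineSpan ℝ _ hp) (subset_affineSpan ℝ _ hu)
  let f : ℝ → affineSpan ℝ (simplex A) := fun t => ⟨AffineMap.lineMap p u t, hmem t⟩
  have hf : Continuous f := Continuous.subtype_mk AffineMap.lineMap_continuous _
  have hf0 : f 0 = y := Subtype.ext (by simp [f, hyp])
  have hev : ∀ᶠ t in 𝓝 (0 : ℝ), (f t : EuclideanSpace ℝ A) ∈ simplex A := by
    rw [mem_interior_iff_mem_nhds, ← hf0] at hy
    exact hf.continuousAt.eventually hy
  obtain ⟨ε, hε, hball⟩ := Metric.eventually_nhds_iff.1 hev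
  -- Negative parameters move from `p` away from the uniform distribution, which makes the zero
  -- coordinate negative.
  have := (hball (y := -(ε / 2)) (by
    rw [Real.dist_eq, sub_zero, abs_neg, abs_of_pos (by positivity)]; linarith)).1 a
  have hval : (f (-(ε / 2)) : EuclideanSpace ℝ A) a = -(ε / 2) * (Fintype.card A : ℝ)⁻¹ := by
    simp [f, AffineMap.lineMap_apply, u, ha]
  rw [hval] at this
  have h2 : 0 < ε / 2 * (Fintype.card A : ℝ)⁻¹ := by positivity
  linarith

end Simplex

/-! ### Geometry of occupancy measures and potential shaping. -/

namespace RegMDP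

variable {S A : Type*} [Fintype S] [Fintype A] (D : RegMDP S A) (P : TransitionLaw S A)

theorem inner_shaping (f : S → ℝ) (μ : EuclideanSpace ℝ (S × A)) :
    inner ℝ ((opE S A - D.γ • opP P) f) μ = ∑ s', f s' *
      (∑ a, μ (s', a) - D.γ * ∑ s, ∑ a, P.prob s a s' * μ (s, a)) := by
  have h1 : ∀ s', f s' * (∑ a, μ (s', a) - D.γ * ∑ s, ∑ a, P.prob s a s' * μ (s, a))
      = ∑ a, f s' * μ (s', a) - ∑ s, ∑ a, D.γ * (P.prob s a s' * f s') * μ (s, a) := by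
    intro s'
    rw [mul_sub, Finset.mul_sum, Finset.mul_sum, Finset.mul_sum]
    congr 1
    refine Finset.sum_congr rfl fun s _ => ?_
    rw [Finset.mul_sum, Finset.mul_sum]
    exact Finset.sum_congr rfl fun a _ => by ring
  simp_rw [h1]
  rw [Finset.sum_sub_distrib, Finset.sum_comm (γ := S) (f := fun s' s =>
    ∑ a, D.γ * (P.prob s a s' * f s') * μ (s, a)), ← Finset.sum_sub_distrib]
  rw [PiLp.inner_apply, Fintype.sum_prod_type]
  refine Finset.sum_congr rfl fun s _ => ?_
  rw [Finset.sum_comm, ← Finset.sum_sub_distrib]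
  refine Finset.sum_congr rfl fun a _ => ?_
  rw [← Finset.sum_mul, ← Finset.mul_sum]
  simp [opE, opP]
  ring

theorem mem_shaping_orthogonal {v : EuclideanSpace ℝ (S × A)} :
    v ∈ (D.shaping P)ᗮ ↔
      ∀ s', ∑ a, v (s', a) - D.γ * ∑ s, ∑ a, P.prob s a s' * v (s, a) = 0 := by
  classical
  rw [Submodule.mem_orthogonal]
  constructor
  · intro h s'
    have := h _ ⟨Pi.single s' 1, rfl⟩
    rw [inner_shaping, Finset.sum_eq_single s'] at this
    · simpa using this
    · intro b _ hb; simp [hb]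
    · simp
  · rintro h _ ⟨f, rfl⟩
    rw [inner_shaping]
    exact Finset.sum_eq_zero fun s' _ => by rw [h s', mul_zero]

theorem flow_sub (μ μ' : EuclideanSpace ℝ (S × A)) (s' : S) :
    ∑ a, (μ' - μ) (s', a) - D.γ * ∑ s, ∑ a, P.prob s a s' * (μ' - μ) (s, a) =
    (∑ a, μ' (s', a) - D.γ * ∑ s, ∑ a, P.prob s a s' * μ' (s, a)) -
      (∑ a, μ (s', a) - D.γ * ∑ s, ∑ a, P.prob s a s' * μ (s, a)) := by
  simp only [PiLp.sub_apply, mul_sub, Finset.sum_sub_distrib]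
  ring

variable {D P}

theorem sub_mem_shaping_orthogonal {μ μ' : EuclideanSpace ℝ (S × A)} (hμ : μ ∈ D.occ P)
    (hμ' : μ' ∈ D.occ P) : μ' - μ ∈ (D.shaping P)ᗮ := by
  rw [mem_shaping_orthogonal]
  intro s'
  rw [flow_sub, hμ.2, hμ'.2, sub_self]

theorem mem_occ_of_sub_mem {μ μ' : EuclideanSpace ℝ (S × A)} (hμ : μ ∈ D.occ P)
    (h : μ' - μ ∈ (D.shaping P)ᗮ) (h0 : ∀ sa, 0 ≤ μ' sa) : μ' ∈ D.occ P := by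
  refine ⟨h0, fun s' => ?_⟩
  have := (D.mem_shaping_orthogonal P).1 h s'
  rw [flow_sub, hμ.2, sub_eq_zero] at this
  exact this

theorem sum_eq_one_of_mem_occ {μ : EuclideanSpace ℝ (S × A)} (hμ : μ ∈ D.occ P) :
    ∑ s, ∑ a, μ (s, a) = 1 := by
  have h1 : ∑ s', (∑ a, μ (s', a) - D.γ * ∑ s, ∑ a, P.prob s a s' * μ (s, a))
      = ∑ s', (1 - D.γ) * D.ν₀ s' := Finset.sum_congr rfl fun s' _ => hμ.2 s'
  have h2 : ∑ s', ∑ s, ∑ a, P.prob s a s' * μ (s, a) = ∑ s, ∑ a, μ (s, a) := by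
    rw [Finset.sum_comm]
    refine Finset.sum_congr rfl fun s _ => ?_
    rw [Finset.sum_comm]
    exact Finset.sum_congr rfl fun a _ => by rw [← Finset.sum_mul, P.sum_eq_one, one_mul]
  rw [← Finset.mul_sum, D.ν₀_sum, Finset.sum_sub_distrib, ← Finset.mul_sum, h2] at h1
  have h3 : (1 - D.γ) * (∑ s, ∑ a, μ (s, a)) = (1 - D.γ) * 1 := by linarith
  exact mul_left_cancel₀ (by linarith [D.γ_lt_one]) h3

theorem apply_le_one_of_mem_occ {μ : EuclideanSpace ℝ (S × A)} (hμ : μ ∈ D.occ P) (sa : S × A) :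
    μ sa ≤ 1 := by
  rw [← sum_eq_one_of_mem_occ hμ, ← Fintype.sum_prod_type (f := fun sa => μ sa)]
  exact Finset.single_le_sum (f := fun sa => μ sa) (fun i _ => hμ.1 i) (Finset.mem_univ sa)

theorem norm_le_one_of_mem_occ {μ : EuclideanSpace ℝ (S × A)} (hμ : μ ∈ D.occ P) : ‖μ‖ ≤ 1 := by
  rw [EuclideanSpace.norm_eq, Real.sqrt_le_one]
  rw [← sum_eq_one_of_mem_occ hμ, ← Fintype.sum_prod_type (f := fun sa => μ sa)]
  refine Finset.sum_le_sum fun sa _ => ?_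
  rw [Real.norm_eq_abs, sq_abs, sq]
  exact mul_le_of_le_one_left (hμ.1 sa) (apply_le_one_of_mem_occ hμ sa)

variable (D P)

theorem isClosed_occ : IsClosed (D.occ P) := by
  have : D.occ P = (⋂ sa, {μ | 0 ≤ μ sa}) ∩ ⋂ s', {μ | ∑ a, μ (s', a)
      - D.γ * ∑ s, ∑ a, P.prob s a s' * μ (s, a) = (1 - D.γ) * D.ν₀ s'} := by
    ext μ; simp [occ]
  rw [this]
  exact (isClosed_iInter fun sa => isClosed_le (by fun_prop) (by fun_prop)).inter
    (isClosed_iInter fun s' => isClosed_eq (by fun_prop) (by fun_prop))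

theorem isCompact_occ : IsCompact (D.occ P) :=
  (isCompact_closedBall (0 : EuclideanSpace ℝ (S × A)) 1).of_isClosed_subset (D.isClosed_occ P)
    fun μ hμ => by simpa using norm_le_one_of_mem_occ hμ

theorem convex_occ : Convex ℝ (D.occ P) := by
  intro μ hμ μ' hμ' a b ha hb hab
  refine mem_occ_of_sub_mem hμ ?_ fun sa => ?_
  · have : a • μ + b • μ' - μ = b • (μ' - μ) := by
      have ha' : a = 1 - b := by linarith
      rw [ha', sub_smul, one_smul, smul_sub]; abel
    rw [this]
    exact Submodule.smul_mem _ _ (sub_mem_shaping_orthogonal hμ hμ')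
  · simpa using add_nonneg (mul_nonneg ha (hμ.1 sa)) (mul_nonneg hb (hμ'.1 sa))

/-- The occupancy measures whose entries are all at least `c`. -/
def occGE (c : ℝ) : Set (EuclideanSpace ℝ (S × A)) := {μ | μ ∈ D.occ P ∧ ∀ sa, c ≤ μ sa}

theorem isClosed_occGE (c : ℝ) : IsClosed (D.occGE P c) := by
  have : D.occGE P c = D.occ P ∩ ⋂ sa, {μ | c ≤ μ sa} := by ext μ; simp [occGE]
  rw [this]
  exact (D.isClosed_occ P).inter (isClosed_iInter fun sa => isClosed_le (by fun_prop) (by fun_prop))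

theorem convex_occGE (c : ℝ) : Convex ℝ (D.occGE P c) := by
  intro μ hμ μ' hμ' a b ha hb hab
  refine ⟨D.convex_occ P hμ.1 hμ'.1 ha hb hab, fun sa => ?_⟩
  have h1 := mul_le_mul_of_nonneg_left (hμ.2 sa) ha
  have h2 := mul_le_mul_of_nonneg_left (hμ'.2 sa) hb
  have h3 : a * c + b * c = c := by rw [← add_mul, hab, one_mul]
  simp only [PiLp.add_apply, PiLp.smul_apply, smul_eq_mul]
  linarith

variable {D P} in
theorem mem_intrinsicInterior_occ {μ : EuclideanSpace ℝ (S × A)} (hμ : μ ∈ D.occ P)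
    (hpos : ∀ sa, 0 < μ sa) : μ ∈ intrinsicInterior ℝ (D.occ P) := by
  refine mem_intrinsicInterior_of_eventually hμ ?_
  have hev : ∀ᶠ y : EuclideanSpace ℝ (S × A) in 𝓝 μ, ∀ a, 0 < y a :=
    eventually_all.2 fun a =>
      (show Continuous fun y : EuclideanSpace ℝ (S × A) => y a by fun_prop).tendsto μ |>.eventually
        (lt_mem_nhds (hpos a))
  filter_upwards [hev] with y hy hspan
  exact mem_occ_of_sub_mem hμ (sub_mem_of_mem_affineSpan
    (fun x hx z hz => sub_mem_shaping_orthogonal hz hx) hμ hspan) fun sa => (hy sa).le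

/-- `E - γP` is injective: at a state maximizing `|f|`, a kernel element satisfies `|f s| ≤ γ |f
s|`. All shaping subspaces thus have the same dimension, as principal angles require. -/
theorem finrank_shaping [Nonempty A] :
    Module.finrank ℝ (D.shaping P) = Fintype.card S := by
  have hinj : Function.Injective (opE S A - D.γ • opP P) := by
    rw [injective_iff_map_eq_zero]
    intro f hf
    rcases isEmpty_or_nonempty S with hS | hS
    · exact Subsingleton.elim _ _
    obtain ⟨a⟩ := ‹Nonempty A›
    obtain ⟨s, hs⟩ := Finite.exists_max fun s => |f s|
    have h1 : f s = D.γ * ∑ s', P.prob s a s' * f s' := by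
      have := congrArg (fun x : EuclideanSpace ℝ (S × A) => x (s, a)) hf
      simp [opE, opP, sub_eq_zero] at this
      exact this
    have h2 : |∑ s', P.prob s a s' * f s'| ≤ |f s| := by
      refine (Finset.abs_sum_le_sum_abs _ _).trans ?_
      calc ∑ s', |P.prob s a s' * f s'| ≤ ∑ s', P.prob s a s' * |f s| := by
            refine Finset.sum_le_sum fun s' _ => ?_
            rw [abs_mul, abs_of_nonneg (P.nonneg s a s')]
            exact mul_le_mul_of_nonneg_left (hs s') (P.nonneg s a s')
        _ = |f s| := by rw [← Finset.sum_mul, P.sum_eq_one, one_mul]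
    have h3 : |f s| ≤ D.γ * |f s| := by
      nth_rw 1 [h1]
      rw [abs_mul, abs_of_pos D.γ_pos]
      exact mul_le_mul_of_nonneg_left h2 D.γ_pos.le
    have h4 : |f s| ≤ 0 := by nlinarith [D.γ_lt_one, abs_nonneg (f s)]
    funext s'
    exact abs_nonpos_iff.1 ((hs s').trans h4)
  rw [shaping, LinearMap.finrank_range_of_inj hinj, Module.finrank_fintype_fun_eq_card]

/-- The state occupancy of the uniform policy. -/
theorem exists_uniform_state_occupancy [Nonempty A] :
    ∃ ν : S → ℝ, (∀ s, 0 ≤ ν s) ∧ ∀ s', ν s' - D.γ * ∑ s, ∑ a, P.prob s a s' *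
      (ν s / Fintype.card A) = (1 - D.γ) * D.ν₀ s' := by
  have hcard : (0 : ℝ) < Fintype.card A := by exact_mod_cast Fintype.card_pos
  let Q : S → S → ℝ := fun s s' => (∑ a, P.prob s a s') / Fintype.card A
  have hQ0 : ∀ s s', 0 ≤ Q s s' := fun s s' =>
    div_nonneg (Finset.sum_nonneg fun a _ => P.nonneg s a s') hcard.le
  have hQ1 : ∀ s, ∑ s', Q s s' = 1 := by
    intro s
    rw [← Finset.sum_div, Finset.sum_comm]
    simp [P.sum_eq_one, hcard.ne']
  -- Discounted flow preserves mass up to the factor `γ < 1`. Applied to `|g|` this gives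
  -- injectivity, hence solvability; applied to the negative part it gives nonnegativity of the
  -- solution.
  have hcontr : ∀ g : S → ℝ, (∀ s', g s' ≤ D.γ * ∑ s, Q s s' * g s) → ∑ s, g s ≤ 0 := by
    intro g hg
    have h1 := Finset.sum_le_sum fun s' (_ : s' ∈ Finset.univ) => hg s'
    rw [← Finset.mul_sum, Finset.sum_comm] at h1
    simp_rw [← Finset.sum_mul, hQ1, one_mul] at h1
    nlinarith [D.γ_lt_one]
  let T : (S → ℝ) →ₗ[ℝ] (S → ℝ) := LinearMap.id - D.γ • Matrix.vecMulLinear (Matrix.of Q)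
  have hT : ∀ g s', T g s' = g s' - D.γ * ∑ s, Q s s' * g s := by
    intro g s'
    simp [T, Matrix.vecMul, dotProduct, mul_comm]
  have hinj : Function.Injective T := by
    rw [injective_iff_map_eq_zero]
    intro g hg
    have h1 : ∀ s', |g s'| ≤ D.γ * ∑ s, Q s s' * |g s| := by
      intro s'
      have h2 := congrFun hg s'
      rw [hT, Pi.zero_apply, sub_eq_zero] at h2
      rw [h2, abs_mul, abs_of_pos D.γ_pos]
      refine mul_le_mul_of_nonneg_left ((Finset.abs_sum_le_sum_abs _ _).trans_eq ?_) D.γ_pos.le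
      exact Finset.sum_congr rfl fun s _ => by rw [abs_mul, abs_of_nonneg (hQ0 s s')]
    have h3 := hcontr (fun s => |g s|) h1
    have h4 := (Finset.sum_eq_zero_iff_of_nonneg fun s _ => abs_nonneg (g s)).1
      (le_antisymm h3 (Finset.sum_nonneg fun s _ => abs_nonneg (g s)))
    funext s
    exact abs_eq_zero.1 (h4 s (Finset.mem_univ s))
  obtain ⟨ν, hν⟩ := (LinearMap.injective_iff_surjective.1 hinj) fun s' => (1 - D.γ) * D.ν₀ s'
  have hν' : ∀ s', ν s' - D.γ * ∑ s, Q s s' * ν s = (1 - D.γ) * D.ν₀ s' := fun s' => by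
    rw [← hT, hν]
  refine ⟨ν, ?_, fun s' => ?_⟩
  · have h1 : ∀ s', max (-ν s') 0 ≤ D.γ * ∑ s, Q s s' * max (-ν s) 0 := by
      intro s'
      refine max_le ?_ (mul_nonneg D.γ_pos.le (Finset.sum_nonneg fun s _ =>
        mul_nonneg (hQ0 s s') (le_max_right _ _)))
      have h2 : 0 ≤ (1 - D.γ) * D.ν₀ s' :=
        mul_nonneg (by linarith [D.γ_lt_one]) (D.ν₀_nonneg s')
      have h3 : -∑ s, Q s s' * ν s ≤ ∑ s, Q s s' * max (-ν s) 0 := by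
        rw [← Finset.sum_neg_distrib]
        refine Finset.sum_le_sum fun s _ => ?_
        rw [← mul_neg]
        exact mul_le_mul_of_nonneg_left (le_max_left _ _) (hQ0 s s')
      have h4 := mul_le_mul_of_nonneg_left h3 D.γ_pos.le
      linarith [hν' s']
    have h3 := hcontr (fun s => max (-ν s) 0) h1
    have h4 := (Finset.sum_eq_zero_iff_of_nonneg fun s _ => le_max_right (-ν s) 0).1
      (le_antisymm h3 (Finset.sum_nonneg fun s _ => le_max_right (-ν s) 0))
    intro s
    have := h4 s (Finset.mem_univ s)
    linarith [le_max_left (-ν s) 0]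
  · rw [← hν' s']
    congr 2
    refine Finset.sum_congr rfl fun s _ => ?_
    rw [← Finset.sum_mul]
    simp only [Q]
    ring

variable {D P}

theorem Exploration.exists_pos_mem_occ [Nonempty A] (hexp : D.Exploration P) :
    ∃ μ ∈ D.occ P, ∀ sa, 0 < μ sa := by
  have hcard : (0 : ℝ) < Fintype.card A := by exact_mod_cast Fintype.card_pos
  obtain ⟨ν, hν0, hν⟩ := D.exists_uniform_state_occupancy P
  let μ : EuclideanSpace ℝ (S × A) := WithLp.toLp 2 fun sa => ν sa.1 / Fintype.card A
  have hsum : ∀ s, ∑ a, μ (s, a) = ν s := fun s => by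
    simp [μ, mul_div_cancel₀ _ hcard.ne']
  have hμ : μ ∈ D.occ P := ⟨fun sa => div_nonneg (hν0 _) hcard.le, fun s' => by
    rw [hsum]; exact hν s'⟩
  obtain ⟨νmin, hmin, h⟩ := hexp
  refine ⟨μ, hμ, fun sa => div_pos ?_ hcard⟩
  have := h μ hμ sa.1
  rw [stateMarginal, hsum] at this
  exact hmin.trans_le this

end RegMDP

/-! ### First-order tools from convex analysis. -/

theorem _root_.ConvexOn.add_inner_gradient_le {V : Type*} [NormedAddCommGroup V]
    [InnerProductSpace ℝ V] [CompleteSpace V] {s : Set V} {f : V → ℝ} (hf : ConvexOn ℝ s f)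
    {x y : V} (hx : x ∈ s) (hy : y ∈ s) (hd : DifferentiableAt ℝ f x) :
    f x + inner ℝ (gradient f x) (y - x) ≤ f y := by
  have hc := hf.comp_affineMap (AffineMap.lineMap x y : ℝ →ᵃ[ℝ] V)
  have hl : HasDerivAt (fun t : ℝ => (AffineMap.lineMap x y : ℝ →ᵃ[ℝ] V) t) (y - x) 0 :=
    AffineMap.hasDerivAt_lineMap
  have hg : HasFDerivAt f (fderiv ℝ f x) ((AffineMap.lineMap x y : ℝ →ᵃ[ℝ] V) (0 : ℝ)) := by
    rw [AffineMap.lineMap_apply_zero]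
    exact hd.hasFDerivAt
  have hD : HasDerivAt (f ∘ (AffineMap.lineMap x y : ℝ →ᵃ[ℝ] V)) (fderiv ℝ f x (y - x)) 0 :=
    hg.comp_hasDerivAt 0 hl
  have := hc.le_slope_of_hasDerivAt (x := 0) (y := 1) (by simpa using hx) (by simpa using hy)
    one_pos hD
  rw [slope_def_field] at this
  simp only [Function.comp_apply, AffineMap.lineMap_apply_one, AffineMap.lineMap_apply_zero,
    sub_zero, div_one] at this
  rw [inner_gradient_left]
  linarith

/-- If the gradients of a convex function blow up along a sequence, then so do its affine minorants,
evaluated at a fixed interior point. -/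
theorem _root_.ConvexOn.tendsto_add_inner_gradient_atBot {V : Type*} [NormedAddCommGroup V]
    [InnerProductSpace ℝ V] [FiniteDimensional ℝ V] {s : Set V} {f : V → ℝ} (hf : ConvexOn ℝ s f)
    (hd : ∀ p ∈ interior s, DifferentiableAt ℝ f p) {x : V} (hx : x ∈ interior s) {p : ℕ → V}
    (hp : ∀ l, p l ∈ interior s)
    (hlim : Tendsto (fun l => ‖gradient f (p l)‖) atTop atTop) :
    Tendsto (fun l => f (p l) + inner ℝ (gradient f (p l)) (x - p l)) atTop atBot := by
  have : ProperSpace V := FiniteDimensional.proper ℝ V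
  obtain ⟨ε, hε, hball⟩ := Metric.isOpen_iff.1 isOpen_interior x hx
  have hsub : Metric.closedBall x (ε / 2) ⊆ interior s :=
    (Metric.closedBall_subset_ball (by linarith)).trans hball
  obtain ⟨C, hC⟩ := (isCompact_closedBall x (ε / 2)).bddAbove_image
    (f := f) fun y hy => (hd y (hsub hy)).continuousAt.continuousWithinAt
  have hle : ∀ l, f (p l) + inner ℝ (gradient f (p l)) (x - p l) ≤
      C + -(ε / 2 * ‖gradient f (p l)‖) := by
    intro l
    set G := gradient f (p l) with hG
    -- Testing the minorant at the point of the ball furthest along the gradient exposes the term `ε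
    -- / 2 * ‖G‖`. For `G = 0` the convention `0⁻¹ = 0` leaves the point at `x`.
    have hmem : x + (ε / 2 * ‖G‖⁻¹) • G ∈ Metric.closedBall x (ε / 2) := by
      rw [mem_closedBall_iff_norm, add_sub_cancel_left, norm_smul, norm_mul, norm_inv, norm_norm,
        Real.norm_of_nonneg (by positivity), mul_assoc]
      exact mul_le_of_le_one_right (by positivity) inv_mul_le_one
    have h1 := hf.add_inner_gradient_le (interior_subset (hp l)) (interior_subset (hsub hmem))
      (hd _ (hp l))
    have h2 : f (x + (ε / 2 * ‖G‖⁻¹) • G) ≤ C := hC (Set.mem_image_of_mem f hmem)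
    have h3 : inner ℝ G (x + (ε / 2 * ‖G‖⁻¹) • G - p l) =
        inner ℝ G (x - p l) + ε / 2 * ‖G‖ := by
      rw [show x + (ε / 2 * ‖G‖⁻¹) • G - p l = (x - p l) + (ε / 2 * ‖G‖⁻¹) • G by abel,
        inner_add_right, inner_smul_right, real_inner_self_eq_norm_sq]
      rcases eq_or_ne ‖G‖ 0 with h0 | h0
      · simp [h0]
      · field_simp
    rw [← hG, h3] at h1
    linarith
  refine tendsto_atBot_mono hle (tendsto_atBot_add_const_left _ _ ?_)
  exact tendsto_neg_atTop_atBot.comp (hlim.const_mul_atTop (by positivity))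

theorem _root_.IsMinOn.inner_gradient_nonneg {V : Type*} [NormedAddCommGroup V]
    [InnerProductSpace ℝ V] [CompleteSpace V] {K : Set V} {f : V → ℝ} {x y : V}
    (hK : Convex ℝ K) (hmin : IsMinOn f K x) (hx : x ∈ K) (hy : y ∈ K)
    (hd : DifferentiableAt ℝ f x) : 0 ≤ inner ℝ (gradient f x) (y - x) := by
  rw [inner_gradient_left]
  exact hmin.localize.hasFDerivWithinAt_nonneg hd.hasFDerivAt.hasFDerivWithinAt
    (sub_mem_posTangentConeAt_of_segment_subset (hK.segment_subset hx hy))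

/-! ### The derivative of `hbar` at positive measures. -/

namespace RegMDP

theorem stateMarginal_pos {S A : Type*} [Fintype A] [Nonempty A] {μ : EuclideanSpace ℝ (S × A)} (hpos : ∀ sa, 0 < μ sa)
    (s : S) : 0 < stateMarginal μ s :=
  Finset.sum_pos (fun a _ => hpos (s, a)) Finset.univ_nonempty

variable {S A : Type*} [Fintype S] [Fintype A] {D : RegMDP S A} {P : TransitionLaw S A}

/-- The section `μ(s, ·)` as a continuous linear map. -/
def sliceL (s : S) : EuclideanSpace ℝ (S × A) →L[ℝ] EuclideanSpace ℝ A :=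
  LinearMap.toContinuousLinearMap
    { toFun := fun μ => WithLp.toLp 2 fun a => μ (s, a)
      map_add' := fun μ μ' => by ext; simp
      map_smul' := fun c μ => by ext; simp }

@[simp] theorem sliceL_apply (s : S) (μ : EuclideanSpace ℝ (S × A)) (a : A) :
    sliceL s μ a = μ (s, a) := rfl

/-- The state marginal as a continuous linear map. -/
def marginalL (s : S) : EuclideanSpace ℝ (S × A) →L[ℝ] ℝ :=
  LinearMap.toContinuousLinearMap
    { toFun := fun μ => stateMarginal μ s
      map_add' := fun μ μ' => by simp [stateMarginal, Finset.sum_add_distrib]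
      map_smul' := fun c μ => by simp [stateMarginal, Finset.mul_sum] }

@[simp] theorem marginalL_apply (s : S) (μ : EuclideanSpace ℝ (S × A)) :
    marginalL s μ = stateMarginal μ s := rfl

theorem policy_eq_smul {μ : EuclideanSpace ℝ (S × A)} {s : S} (h : 0 < stateMarginal μ s) :
    policy μ s = (stateMarginal μ s)⁻¹ • sliceL s μ := by
  ext a
  simp [policy, h, div_eq_inv_mul]

theorem smul_policy {μ : EuclideanSpace ℝ (S × A)} {s : S} (h : 0 < stateMarginal μ s) :
    stateMarginal μ s • policy μ s = sliceL s μ := by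
  rw [policy_eq_smul h, smul_smul, mul_inv_cancel₀ h.ne', one_smul]

theorem policy_mem_simplex {μ : EuclideanSpace ℝ (S × A)} {s : S} (h0 : ∀ sa, 0 ≤ μ sa)
    (h : 0 < stateMarginal μ s) : policy μ s ∈ simplex A := by
  rw [policy_eq_smul h]
  refine ⟨fun a => ?_, ?_⟩
  · simpa using mul_nonneg (inv_nonneg.2 h.le) (h0 (s, a))
  · simp only [PiLp.smul_apply, sliceL_apply, smul_eq_mul, ← Finset.mul_sum]
    exact inv_mul_cancel₀ h.ne'

theorem policy_mem_interior [Nonempty A] {μ : EuclideanSpace ℝ (S × A)} (hpos : ∀ sa, 0 < μ sa)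
    (s : S) : policy μ s ∈ interior D.X := by
  have h := stateMarginal_pos hpos s
  refine D.simplex_subset (mem_intrinsicInterior_simplex
    (policy_mem_simplex (fun sa => (hpos sa).le) h) fun a => ?_)
  rw [policy_eq_smul h]
  exact mul_pos (inv_pos.2 h) (hpos (s, a))

theorem hbar_eq_sum_stateMarginal (μ : EuclideanSpace ℝ (S × A)) :
    D.hbar μ = ∑ s, stateMarginal μ s * D.h (policy μ s) := by
  simp only [hbar, stateMarginal, Finset.sum_mul]

/-- Near a positive measure, `hbar` is a sum over states of perspectives `ν h(μ/ν)`, differentiated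
by the product and chain rules. -/
theorem hasFDerivAt_hbar [Nonempty A] (hdiff : ∀ p ∈ interior D.X, DifferentiableAt ℝ D.h p)
    {μ : EuclideanSpace ℝ (S × A)} (hpos : ∀ sa, 0 < μ sa) :
    ∃ L : EuclideanSpace ℝ (S × A) →L[ℝ] ℝ, HasFDerivAt D.hbar L μ ∧
      ∀ d, L d = ∑ s, (stateMarginal d s * D.h (policy μ s) +
        inner ℝ (gradient D.h (policy μ s)) (sliceL s d - stateMarginal d s • policy μ s)) := by
  have hν : ∀ s, 0 < stateMarginal μ s := stateMarginal_pos hpos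
  have hπ : ∀ s, HasFDerivAt (fun x : EuclideanSpace ℝ (S × A) => (marginalL s x)⁻¹ • sliceL s x)
      _ μ := fun s => ((hasDerivAt_inv (hν s).ne').comp_hasFDerivAt μ
        (marginalL s).hasFDerivAt).smul (sliceL s).hasFDerivAt
  have hh : ∀ s, HasFDerivAt D.h (fderiv ℝ D.h (policy μ s))
      ((marginalL s μ)⁻¹ • sliceL s μ) := by
    intro s
    rw [marginalL_apply, ← policy_eq_smul (hν s)]
    exact (hdiff _ (policy_mem_interior hpos s)).hasFDerivAt
  have hsum := HasFDerivAt.fun_sum fun s (_ : s ∈ (Finset.univ : Finset S)) =>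
    (marginalL s).hasFDerivAt.mul ((hh s).comp μ (hπ s))
  have hev : ∀ᶠ x : EuclideanSpace ℝ (S × A) in 𝓝 μ, ∀ s, 0 < stateMarginal x s :=
    eventually_all.2 fun s => (marginalL s).continuous.tendsto μ |>.eventually (lt_mem_nhds (hν s))
  refine ⟨_, hsum.congr_of_eventuallyEq ?_, fun d => ?_⟩
  · filter_upwards [hev] with x hx
    rw [hbar_eq_sum_stateMarginal]
    refine Finset.sum_congr rfl fun s _ => ?_
    rw [policy_eq_smul (hx s)]
    rfl
  · rw [sum_apply]
    refine Finset.sum_congr rfl fun s _ => ?_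
    have h1 : sliceL s d - stateMarginal d s • policy μ s = stateMarginal μ s •
        ((stateMarginal μ s)⁻¹ • sliceL s d -
          ((stateMarginal μ s ^ 2)⁻¹ * stateMarginal d s) • sliceL s μ) := by
      rw [policy_eq_smul (hν s), smul_sub, smul_smul, smul_smul, smul_smul,
        mul_inv_cancel₀ (hν s).ne', one_smul]
      congr 2
      have := (hν s).ne'
      field_simp
    rw [h1, inner_smul_right, inner_gradient_left]
    simp [policy_eq_smul (hν s)]
    ring

theorem differentiableAt_hbar [Nonempty A]
    (hdiff : ∀ p ∈ interior D.X, DifferentiableAt ℝ D.h p)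
    {μ : EuclideanSpace ℝ (S × A)} (hpos : ∀ sa, 0 < μ sa) : DifferentiableAt ℝ D.hbar μ := by
  obtain ⟨L, hL, -⟩ := hasFDerivAt_hbar hdiff hpos
  exact hL.differentiableAt

/-- This writes the directional derivative through tangent minorants of `h` evaluated at the policy
of `u`, the quantities that steepness drives to `-∞`. -/
theorem inner_gradient_hbar_sub [Nonempty A]
    (hdiff : ∀ p ∈ interior D.X, DifferentiableAt ℝ D.h p)
    {μ u : EuclideanSpace ℝ (S × A)} (hpos : ∀ sa, 0 < μ sa) (hu : ∀ sa, 0 < u sa) :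
    inner ℝ (gradient D.hbar μ) (u - μ) = ∑ s, stateMarginal u s * (D.h (policy μ s) +
      inner ℝ (gradient D.h (policy μ s)) (policy u s - policy μ s)) - D.hbar μ := by
  obtain ⟨L, hL, hd⟩ := hasFDerivAt_hbar hdiff hpos
  rw [inner_gradient_left, hL.fderiv, hd, hbar_eq_sum_stateMarginal, ← Finset.sum_sub_distrib]
  refine Finset.sum_congr rfl fun s _ => ?_
  have h1 : stateMarginal (u - μ) s = stateMarginal u s - stateMarginal μ s :=
    map_sub (marginalL s) u μ
  have h2 : sliceL s (u - μ) - stateMarginal (u - μ) s • policy μ s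
      = stateMarginal u s • (policy u s - policy μ s) := by
    rw [map_sub, h1, ← smul_policy (stateMarginal_pos hpos s),
      ← smul_policy (stateMarginal_pos hu s), sub_smul, smul_sub]
    abel
  rw [h2, h1, inner_smul_right]
  ring

/-! ### Steepness and the existence of interior optima. -/

/-- First-order optimality at a positive occupancy measure. -/
def IsInteriorOptimum (D : RegMDP S A) (P : TransitionLaw S A)
    (r μ : EuclideanSpace ℝ (S × A)) : Prop :=
  μ ∈ D.occ P ∧ (∀ sa, 0 < μ sa) ∧
    ∀ v ∈ (D.shaping P)ᗮ, inner ℝ (gradient D.hbar μ) v = inner ℝ r v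

/-- Under steepness, limits of occupancy measures along which the directional derivatives of `h̄`
towards a fixed positive measure stay bounded below are positive. -/
theorem Steep.pos_of_tendsto [Nonempty A] (hsteep : D.Steep) (hexp : D.Exploration P)
    {u : EuclideanSpace ℝ (S × A)} (hu : ∀ sa, 0 < u sa)
    {m : ℕ → EuclideanSpace ℝ (S × A)} (hm : ∀ n, m n ∈ D.occ P) (hpos : ∀ n sa, 0 < m n sa)
    {C₁ C₂ : ℝ} (hC₁ : ∀ n, C₁ ≤ inner ℝ (gradient D.hbar (m n)) (u - m n))
    (hC₂ : ∀ n, C₂ ≤ D.hbar (m n)) {μ : EuclideanSpace ℝ (S × A)}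
    (hlim : Tendsto m atTop (𝓝 μ)) : ∀ sa, 0 < μ sa := by
  classical
  have hμ : μ ∈ D.occ P := (D.isClosed_occ P).mem_of_tendsto hlim (Eventually.of_forall hm)
  obtain ⟨νmin, hνmin, hν⟩ := hexp
  by_contra! hcon
  obtain ⟨⟨s, a⟩, hsa⟩ := hcon
  have hsa0 : μ (s, a) = 0 := le_antisymm hsa (hμ.1 _)
  have hνs : 0 < stateMarginal μ s := hνmin.trans_le (hν μ hμ s)
  have hfront : policy μ s ∈ intrinsicFrontier ℝ (simplex A) := by
    refine mem_intrinsicFrontier_simplex (a := a) (policy_mem_simplex hμ.1 hνs) ?_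
    simp [policy_eq_smul hνs, hsa0]
  have hpol : Tendsto (fun n => policy (m n) s) atTop (𝓝 (policy μ s)) := by
    have h1 : (fun n => policy (m n) s) = fun n => (marginalL s (m n))⁻¹ • sliceL s (m n) :=
      funext fun n => policy_eq_smul (stateMarginal_pos (hpos n) s)
    rw [h1, policy_eq_smul hνs]
    exact ((((marginalL s).continuous.tendsto μ).comp hlim).inv₀ hνs.ne').smul
      (((sliceL s).continuous.tendsto μ).comp hlim)
  have hgrad := hsteep.2 _ _ (fun n => policy_mem_interior (hpos n) s) hfront hpol
  have hbot := D.h_strictConvex.convexOn.tendsto_add_inner_gradient_atBot hsteep.1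
    (policy_mem_interior hu s) (fun n => policy_mem_interior (hpos n) s) hgrad
  set T : ℕ → ℝ := fun n => D.h (policy (m n) s) +
    inner ℝ (gradient D.h (policy (m n) s)) (policy u s - policy (m n) s) with hT
  -- By convexity `B` bounds the contribution of all other states, so the divergence at `s` cannot
  -- be compensated.
  set B : ℝ := ∑ s' ∈ Finset.univ.erase s, stateMarginal u s' * D.h (policy u s') with hB
  have hle : ∀ n, C₁ + C₂ - B ≤ stateMarginal u s * T n := by
    intro n
    have h1 := hC₁ n
    rw [inner_gradient_hbar_sub hsteep.1 (hpos n) hu,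
      ← Finset.add_sum_erase _ _ (Finset.mem_univ s)] at h1
    have h2 : ∑ s' ∈ Finset.univ.erase s, stateMarginal u s' * (D.h (policy (m n) s') +
        inner ℝ (gradient D.h (policy (m n) s')) (policy u s' - policy (m n) s')) ≤ B := by
      refine Finset.sum_le_sum fun s' _ => mul_le_mul_of_nonneg_left ?_ (stateMarginal_pos hu s').le
      exact D.h_strictConvex.convexOn.add_inner_gradient_le
        (interior_subset (policy_mem_interior (hpos n) s'))
        (interior_subset (policy_mem_interior hu s'))
        (hsteep.1 _ (policy_mem_interior (hpos n) s'))
    have h3 := hC₂ n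
    simp only [hT]
    linarith
  have hbot' := hbot.const_mul_atBot (stateMarginal_pos hu s)
  obtain ⟨n, hn⟩ := (hbot'.eventually (eventually_lt_atBot (C₁ + C₂ - B))).exists
  exact absurd (hle n) (not_le.2 hn)

theorem exists_isInteriorOptimum [Nonempty S] [Nonempty A] {η : ℝ} (hη : 0 ≤ η)
    (hsteep : D.Steep) (hexp : D.Exploration P) (hconv : D.StronglyConvex P η)
    (r : EuclideanSpace ℝ (S × A)) : ∃ μ, D.IsInteriorOptimum P r μ := by
  obtain ⟨u, hu, hupos⟩ := hexp.exists_pos_mem_occ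
  obtain ⟨i₀, hi₀⟩ := Finite.exists_min fun sa => u sa
  set c : ℝ := u i₀ with hc
  have hc0 : 0 < c := hupos i₀
  -- Minimizing over truncations away from the boundary avoids any need for continuity of `hbar`
  -- there. As `c` is the least entry of `u`, every truncation contains `u`.
  let K : ℕ → Set (EuclideanSpace ℝ (S × A)) := fun n => D.occGE P (c / (n + 1))
  have hcn : ∀ n : ℕ, 0 < c / (n + 1) := fun n => by positivity
  have hKpos : ∀ n, ∀ μ ∈ K n, ∀ sa, 0 < μ sa := fun n μ hμ sa => (hcn n).trans_le (hμ.2 sa)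
  have hKcomp : ∀ n, IsCompact (K n) := fun n =>
    (D.isCompact_occ P).of_isClosed_subset (D.isClosed_occGE P _) fun μ hμ => hμ.1
  have hKconv : ∀ n, Convex ℝ (K n) := fun n => D.convex_occGE P _
  have huK : ∀ n, u ∈ K n := fun n => ⟨hu, fun sa =>
    (div_le_self hc0.le (by linarith [(Nat.cast_nonneg n : (0 : ℝ) ≤ n)])).trans (hi₀ sa)⟩
  set g : EuclideanSpace ℝ (S × A) → ℝ := fun μ => D.hbar μ - inner ℝ r μ with hg
  have hgrad : ∀ μ : EuclideanSpace ℝ (S × A), (∀ sa, 0 < μ sa) →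
      HasGradientAt g (gradient D.hbar μ - r) μ := by
    intro μ hμ
    have h1 := (differentiableAt_hbar hsteep.1 hμ).hasGradientAt
    rw [hasGradientAt_iff_hasFDerivAt] at h1 ⊢
    rw [map_sub]
    exact h1.sub ((InnerProductSpace.toDual ℝ _ r).hasFDerivAt)
  choose m hmK hmin using fun n => (hKcomp n).exists_isMinOn ⟨u, huK n⟩ (f := g) fun μ hμ =>
    (hgrad μ (hKpos n μ hμ)).continuousAt.continuousWithinAt
  have hmocc : ∀ n, m n ∈ D.occ P := fun n => (hmK n).1
  obtain ⟨μ, hμ, φ, hφ, hlim⟩ := (D.isCompact_occ P).tendsto_subseq hmocc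
  have hnorm : ∀ x ∈ D.occ P, ‖u - x‖ ≤ 2 := fun x hx =>
    (norm_sub_le _ _).trans (by linarith [norm_le_one_of_mem_occ hx, norm_le_one_of_mem_occ hu])
  have hpos : ∀ sa, 0 < μ sa := by
    -- `C₁` comes from the first-order condition at the truncated minimizers in direction `u`, `C₂`
    -- from strong convexity at `u`; norms of differences are at most `2`.
    refine hsteep.pos_of_tendsto hexp hupos (m := m ∘ φ) (fun n => hmocc _)
      (fun n => hKpos _ _ (hmK _)) (C₁ := -(‖r‖ * 2))
      (C₂ := D.hbar u - ‖gradient D.hbar u‖ * 2) (fun n => ?_) (fun n => ?_) hlim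
    · have h1 := (hmin (φ n)).inner_gradient_nonneg (hKconv _) (hmK _) (huK _)
        (hgrad _ (hKpos _ _ (hmK _))).differentiableAt
      rw [(hgrad _ (hKpos _ _ (hmK _))).gradient, inner_sub_left] at h1
      have h2 := neg_le_of_abs_le (abs_real_inner_le_norm r (u - m (φ n)))
      have h3 := mul_le_mul_of_nonneg_left (hnorm _ (hmocc (φ n))) (norm_nonneg r)
      simp only [Function.comp_apply]
      linarith
    · have h1 := hconv u (mem_intrinsicInterior_occ hu hupos) (m (φ n)) (hmocc _)
      have h2 := neg_le_of_abs_le (abs_real_inner_le_norm (gradient D.hbar u) (m (φ n) - u))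
      have h3 := mul_le_mul_of_nonneg_left (hnorm _ (hmocc (φ n))) (norm_nonneg (gradient D.hbar u))
      rw [norm_sub_rev] at h3
      have h4 : 0 ≤ η / 2 * ‖m (φ n) - u‖ ^ 2 := by positivity
      simp only [Function.comp_apply]
      linarith
  refine ⟨μ, hμ, hpos, fun v hv => ?_⟩
  have hopt : ∀ x ∈ D.occ P, (∀ sa, 0 < x sa) → g μ ≤ g x := by
    intro x hx hxpos
    refine le_of_tendsto ((hgrad μ hpos).continuousAt.tendsto.comp hlim) ?_
    have hev : ∀ᶠ n : ℕ in atTop, ∀ sa, c / (n + 1) ≤ x sa := by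
      refine eventually_all.2 fun sa => ?_
      have h1 : Tendsto (fun n : ℕ => c / ((n : ℝ) + 1)) atTop (𝓝 0) := by
        simpa [div_eq_mul_one_div c] using
          (tendsto_one_div_add_atTop_nhds_zero_nat (𝕜 := ℝ)).const_mul c
      exact (h1.eventually (gt_mem_nhds (hxpos sa))).mono fun n hn => hn.le
    exact (hφ.tendsto_atTop.eventually hev).mono fun n hn => hmin (φ n) ⟨hx, hn⟩
  have hline : HasDerivAt (fun t : ℝ => μ + t • v) v 0 := by
    simpa using ((hasDerivAt_id (0 : ℝ)).smul_const v).const_add μ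
  -- Positivity of `μ` allows both signs of `t`, so the first-order condition is an equality.
  have hmem : IsLocalMin (g ∘ fun t : ℝ => μ + t • v) 0 := by
    have hev : ∀ᶠ t : ℝ in 𝓝 0, ∀ sa, 0 < (μ + t • v) sa := by
      refine eventually_all.2 fun sa => ?_
      have hct : Continuous fun t : ℝ => (μ + t • v) sa := by
        simp only [PiLp.add_apply, PiLp.smul_apply]; fun_prop
      exact hct.continuousAt.eventually (lt_mem_nhds (by simpa using hpos sa))
    filter_upwards [hev] with t ht
    simp only [Function.comp_apply, zero_smul, add_zero]
    refine hopt _ (mem_occ_of_sub_mem hμ ?_ fun sa => (ht sa).le) ht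
    rw [add_sub_cancel_left]
    exact Submodule.smul_mem _ _ hv
  have hG : HasFDerivAt g (InnerProductSpace.toDual ℝ _ (gradient D.hbar μ - r))
      (μ + (0 : ℝ) • v) := by
    simpa using (hgrad μ hpos).hasFDerivAt
  have h0 := hmem.hasDerivAt_eq_zero (hG.comp_hasDerivAt 0 hline)
  rw [InnerProductSpace.toDual_apply_apply, inner_sub_left, sub_eq_zero] at h0
  exact h0

end RegMDP

/-! ### Quadratic growth and the gradient of the optimal value. -/

namespace RegMDP

variable {S A : Type*} [Fintype S] [Fintype A] {D : RegMDP S A} {P : TransitionLaw S A} {η : ℝ}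

theorem J_eq_add_inner (r r' μ : EuclideanSpace ℝ (S × A)) :
    D.J r' μ = D.J r μ + inner ℝ (r' - r) μ := by
  rw [J, J, inner_sub_left]; ring

namespace IsInteriorOptimum

variable {r r' μ μ' : EuclideanSpace ℝ (S × A)}

theorem J_add_le (h : D.IsInteriorOptimum P r μ) (hconv : D.StronglyConvex P η)
    (hμ' : μ' ∈ D.occ P) : D.J r μ' + η / 2 * ‖μ' - μ‖ ^ 2 ≤ D.J r μ := by
  have h1 := hconv μ (mem_intrinsicInterior_occ h.1 h.2.1) μ' hμ'
  rw [h.2.2 _ (sub_mem_shaping_orthogonal h.1 hμ'), inner_sub_right] at h1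
  rw [J, J]
  linarith

theorem J_le (h : D.IsInteriorOptimum P r μ) (hη : 0 ≤ η) (hconv : D.StronglyConvex P η)
    (hμ' : μ' ∈ D.occ P) : D.J r μ' ≤ D.J r μ := by
  have := h.J_add_le hconv hμ'
  have h2 : 0 ≤ η / 2 * ‖μ' - μ‖ ^ 2 := by positivity
  linarith

theorem RL_eq (h : D.IsInteriorOptimum P r μ) (hη : 0 < η) (hconv : D.StronglyConvex P η) :
    D.RL P r = {μ} := by
  ext x
  refine ⟨fun hx => ?_, ?_⟩
  · have h1 := h.J_add_le hconv hx.1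
    have h2 := hx.2 μ h.1
    have h3 : ‖x - μ‖ ^ 2 ≤ 0 := by
      by_contra! hlt
      have : 0 < η / 2 * ‖x - μ‖ ^ 2 := by positivity
      linarith
    have h4 : ‖x - μ‖ = 0 := pow_eq_zero_iff two_ne_zero |>.1 (le_antisymm h3 (sq_nonneg _))
    exact sub_eq_zero.1 (norm_eq_zero.1 h4)
  · rintro rfl
    exact ⟨h.1, fun μ' hμ' => h.J_le hη.le hconv hμ'⟩

theorem optValue_eq (h : D.IsInteriorOptimum P r μ) (hη : 0 ≤ η) (hconv : D.StronglyConvex P η) :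
    D.optValue P r = D.J r μ := by
  refine IsGreatest.csSup_eq ⟨Set.mem_image_of_mem _ h.1, ?_⟩
  rintro _ ⟨μ', hμ', rfl⟩
  exact h.J_le hη hconv hμ'

/-- Adding the growth inequalities at both optima gives `η ‖μ' - μ‖² ≤ ⟨r' - r, μ' - μ⟩`. -/
theorem mul_norm_sub_le (h : D.IsInteriorOptimum P r μ) (h' : D.IsInteriorOptimum P r' μ')
    (hconv : D.StronglyConvex P η) : η * ‖μ' - μ‖ ≤ ‖r' - r‖ := by
  have h1 := h.J_add_le hconv h'.1
  have h2 := h'.J_add_le hconv h.1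
  rw [norm_sub_rev, J_eq_add_inner r, J_eq_add_inner r r' μ'] at h2
  have h3 : inner ℝ (r' - r) (μ' - μ) ≤ ‖r' - r‖ * ‖μ' - μ‖ := real_inner_le_norm _ _
  rw [inner_sub_right] at h3
  rcases (norm_nonneg (μ' - μ)).eq_or_lt with h0 | h0
  · rw [← h0, mul_zero]; exact norm_nonneg _
  · refine le_of_mul_le_mul_right ?_ h0
    linarith

/-- Optimality of each measure for its own reward puts the remainder between `0` and `⟨r' - r, μ' -
μ⟩`. -/
theorem optValue_sub_le (h : D.IsInteriorOptimum P r μ) (h' : D.IsInteriorOptimum P r' μ')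
    (hη : 0 < η) (hconv : D.StronglyConvex P η) :
    |D.optValue P r' - D.optValue P r - inner ℝ μ (r' - r)| ≤ η⁻¹ * ‖r' - r‖ ^ 2 := by
  have h1 := h.J_le hη.le hconv h'.1
  have h2 := h'.J_le hη.le hconv h.1
  have h3 := h.mul_norm_sub_le h' hconv
  rw [h.optValue_eq hη.le hconv, h'.optValue_eq hη.le hconv, real_inner_comm]
  rw [J_eq_add_inner r] at h2
  have h4 : inner ℝ (r' - r) (μ' - μ) ≤ ‖r' - r‖ * ‖μ' - μ‖ := real_inner_le_norm _ _
  have h5 : ‖r' - r‖ * ‖μ' - μ‖ ≤ η⁻¹ * ‖r' - r‖ ^ 2 := by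
    rw [sq, mul_left_comm]
    refine mul_le_mul_of_nonneg_left ?_ (norm_nonneg _)
    rwa [le_inv_mul_iff₀ hη]
  rw [inner_sub_right] at h4
  have h6 := J_eq_add_inner (D := D) r r' μ'
  rw [abs_of_nonneg (by linarith)]
  linarith

end IsInteriorOptimum

/-- The optimal value is differentiable, with the optimal occupancy measure as its gradient. -/
theorem hasGradientAt_optValue {sol : EuclideanSpace ℝ (S × A) → EuclideanSpace ℝ (S × A)}
    (hsol : ∀ r, D.IsInteriorOptimum P r (sol r)) (hη : 0 < η) (hconv : D.StronglyConvex P η)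
    (r : EuclideanSpace ℝ (S × A)) : HasGradientAt (D.optValue P) (sol r) r := by
  rw [hasGradientAt_iff_isLittleO]
  refine Asymptotics.IsBigO.trans_isLittleO (g := fun r' => ‖r' - r‖ ^ 2) ?_
    (Asymptotics.isLittleO_pow_sub_sub r one_lt_two)
  refine Asymptotics.IsBigO.of_bound η⁻¹ (Eventually.of_forall fun r' => ?_)
  rw [Real.norm_eq_abs, norm_pow, norm_norm]
  exact (hsol r).optValue_sub_le (hsol r') hη hconv

/-! ### Existence of a dual strong convexity constant. -/

theorem exists_lower_bound_of_isCompact [Nonempty S] [Nonempty A]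
    {sol : EuclideanSpace ℝ (S × A) → EuclideanSpace ℝ (S × A)}
    (hsol : ∀ r, D.IsInteriorOptimum P r (sol r)) (hη : 0 < η) (hconv : D.StronglyConvex P η)
    {R : Set (EuclideanSpace ℝ (S × A))} (hR : IsCompact R) :
    ∃ c > 0, ∀ r ∈ R, ∀ sa, c ≤ sol r sa := by
  have hlip : LipschitzWith (Real.toNNReal η⁻¹) sol := by
    refine LipschitzWith.of_dist_le_mul fun r r' => ?_
    rw [dist_eq_norm, dist_eq_norm, Real.coe_toNNReal _ (inv_nonneg.2 hη.le), le_inv_mul_iff₀ hη]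
    exact (hsol r').mul_norm_sub_le (hsol r) hconv
  have hcont := hlip.continuous
  have hex : ∀ sa, ∃ c, 0 < c ∧ ∀ r ∈ R, c ≤ sol r sa := fun sa =>
    hR.exists_forall_le' (f := fun r => sol r sa) (by fun_prop) fun r _ => (hsol r).2.1 sa
  choose c hc0 hc using hex
  obtain ⟨i, hi⟩ := Finite.exists_min c
  exact ⟨c i, hc0 i, fun r hr sa => (hi sa).trans (hc sa r hr)⟩

theorem exists_isDualStrongConvexityConstant [Nonempty S] [Nonempty A]
    (hsteep : D.Steep) (hexp : D.Exploration P) (hη : 0 < η) (hreg : D.Regularity P η)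
    {R : Set (EuclideanSpace ℝ (S × A))} (hR : IsCompact R) :
    ∃ σ, D.IsDualStrongConvexityConstant P R σ := by
  obtain ⟨hconv, hlip⟩ := hreg
  choose sol hsol using D.exists_isInteriorOptimum hη.le hsteep hexp hconv
  obtain ⟨c, hc0, hc⟩ := exists_lower_bound_of_isCompact hsol hη hconv hR
  have hKint : D.occGE P (c / 2) ⊆ intrinsicInterior ℝ (D.occ P) := fun μ hμ =>
    mem_intrinsicInterior_occ hμ.1 fun sa => (half_pos hc0).trans_le (hμ.2 sa)
  obtain ⟨L, hL0, hL⟩ := hlip _ hKint (D.isClosed_occGE P _) (D.convex_occGE P _)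
  have hdiam : 0 ≤ Metric.diam R := Metric.diam_nonneg
  -- The first bound makes the loss `L t² ‖v‖²` at most half the gain `t ‖v‖²`; the second keeps all
  -- entries of `μ + t • v` above `c / 2`. The `+ 1` covers diameter zero.
  set t : ℝ := min (1 / (2 * L)) (c / (2 * (Metric.diam R + 1))) with ht
  have ht0 : 0 < t := lt_min (by positivity) (by positivity)
  refine ⟨t, ht0, fun r hr r' hr' => ?_⟩
  rw [(hasGradientAt_optValue hsol hη hconv r).gradient, ← map_sub,
    norm_mkQ_eq_norm_starProjection_orthogonal]
  set μ := sol r with hμ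
  set v := (D.shaping P)ᗮ.starProjection (r' - r) with hv
  have hvmem : v ∈ (D.shaping P)ᗮ := (D.shaping P)ᗮ.starProjection_apply_mem _
  have hvin : inner ℝ (r' - r) v = ‖v‖ ^ 2 := by
    have := (D.shaping P)ᗮ.starProjection_inner_eq_zero (r' - r) v hvmem
    rw [← hv, inner_sub_left, sub_eq_zero, real_inner_self_eq_norm_sq] at this
    exact this
  have hvnorm : ‖v‖ ≤ Metric.diam R :=
    ((D.shaping P)ᗮ.norm_starProjection_apply_le _).trans (by
      rw [← dist_eq_norm]; exact Metric.dist_le_diam_of_mem hR.isBounded hr' hr)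
  have htv : t * ‖v‖ ≤ c / 2 := by
    have h1 : t * ‖v‖ ≤ c / (2 * (Metric.diam R + 1)) * (Metric.diam R + 1) :=
      mul_le_mul (min_le_right _ _) (by linarith) (norm_nonneg _) (by positivity)
    have h2 : c / (2 * (Metric.diam R + 1)) * (Metric.diam R + 1) = c / 2 := by field_simp
    linarith
  have hxge : ∀ sa, c / 2 ≤ (μ + t • v) sa := by
    intro sa
    have h1 := hc r hr sa
    have h2 : |v sa| ≤ ‖v‖ := by
      rw [← Real.norm_eq_abs]; exact PiLp.norm_apply_le v sa
    have h3 := mul_le_mul_of_nonneg_left h2 ht0.le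
    have h4 := mul_le_mul_of_nonneg_left (neg_le_of_abs_le h2) ht0.le
    simp only [PiLp.add_apply, PiLp.smul_apply, smul_eq_mul]
    linarith
  have hxocc : μ + t • v ∈ D.occ P := mem_occ_of_sub_mem (hsol r).1 (by
    rw [add_sub_cancel_left]; exact Submodule.smul_mem _ _ hvmem) fun sa =>
      (half_pos hc0).le.trans (hxge sa)
  have hxK : μ + t • v ∈ D.occGE P (c / 2) := ⟨hxocc, hxge⟩
  have hμK : μ ∈ D.occGE P (c / 2) := ⟨(hsol r).1, fun sa => by linarith [hc r hr sa]⟩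
  -- A descent lemma without integration: convexity at the endpoint `μ + t • v`, then comparison of
  -- the two gradients. This yields `L` in place of `L / 2`.
  have hdesc : D.hbar (μ + t • v) ≤ D.hbar μ + t * inner ℝ r v + L * t ^ 2 * ‖v‖ ^ 2 := by
    have h1 := hconv _ (hKint hxK) μ (hsol r).1
    have h2 := hL _ hxK _ hμK
    have h3 := real_inner_le_norm (gradient D.hbar (μ + t • v) - gradient D.hbar μ) (t • v)
    rw [add_sub_cancel_left] at h2
    have h4 := mul_le_mul_of_nonneg_right h2 (norm_nonneg (t • v))
    have h5 : ‖t • v‖ = t * ‖v‖ := by rw [norm_smul, Real.norm_of_nonneg ht0.le]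
    have h6 : μ - (μ + t • v) = -(t • v) := by abel
    rw [inner_sub_left, inner_smul_right (gradient D.hbar μ), (hsol r).2.2 v hvmem] at h3
    rw [h6, inner_neg_right, norm_neg, h5] at h1
    rw [h5] at h3 h4
    have h7 : 0 ≤ η / 2 * (t * ‖v‖) ^ 2 := by positivity
    nlinarith
  have hJ := (hsol r').J_le hη.le hconv hxocc
  rw [← (hsol r').optValue_eq hη.le hconv] at hJ
  rw [(hsol r).optValue_eq hη.le hconv]
  have htL : L * t ^ 2 * ‖v‖ ^ 2 ≤ t / 2 * ‖v‖ ^ 2 := by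
    refine mul_le_mul_of_nonneg_right ?_ (sq_nonneg _)
    have h1 : t * (2 * L) ≤ 1 := by
      rw [← le_div_iff₀ (by positivity)]; exact min_le_left _ _
    nlinarith
  rw [J, inner_add_right, inner_smul_right] at hJ
  rw [inner_sub_left] at hvin
  rw [J, ← hμ, inner_sub_right, real_inner_comm r' μ, real_inner_comm r μ]
  have h8 : t * (inner ℝ r' v - inner ℝ r v) = t * ‖v‖ ^ 2 := by rw [hvin]
  linarith

/-! ### Suboptimality and distance modulo shaping. -/

/-- The optimum for one reward is suboptimal for another one by at most the squared distance of the
rewards modulo potential shaping, divided by `2η`. -/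
theorem IsInteriorOptimum.subOpt_le {r r' μ μ' : EuclideanSpace ℝ (S × A)}
    (h : D.IsInteriorOptimum P r μ) (h' : D.IsInteriorOptimum P r' μ') (hη : 0 < η)
    (hconv : D.StronglyConvex P η) :
    D.SubOpt P r' μ ≤ ‖(D.shaping P).mkQ (r' - r)‖ ^ 2 / (2 * η) := by
  rw [SubOpt, h'.optValue_eq hη.le hconv, norm_mkQ_eq_norm_starProjection_orthogonal,
    le_div_iff₀ (by positivity)]
  have h1 := h.J_add_le hconv h'.1
  have hd := sub_mem_shaping_orthogonal h.1 h'.1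
  have h2 := (D.shaping P)ᗮ.starProjection_inner_eq_zero (r' - r) _ hd
  have h3 := real_inner_le_norm ((D.shaping P)ᗮ.starProjection (r' - r)) (μ' - μ)
  rw [inner_sub_left, sub_eq_zero] at h2
  rw [← h2, inner_sub_right] at h3
  have e1 := J_eq_add_inner (D := D) r r' μ'
  have e2 := J_eq_add_inner (D := D) r r' μ
  have h4 : D.J r' μ' - D.J r' μ ≤ ‖(D.shaping P)ᗮ.starProjection (r' - r)‖ * ‖μ' - μ‖ -
      η / 2 * ‖μ' - μ‖ ^ 2 := by linarith
  -- Completing the square: `q x - η x² / 2 ≤ q² / (2η)`.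
  nlinarith [sq_nonneg (‖(D.shaping P)ᗮ.starProjection (r' - r)‖ - η * ‖μ' - μ‖),
    mul_le_mul_of_nonneg_right h4 (by positivity : 0 ≤ 2 * η)]

/-- Since `sol r` is the gradient at `r`, the Bregman divergence of `optValue` from `r` to `r'` is
exactly the suboptimality of `sol r` for `r'`. -/
theorem IsDualStrongConvexityConstant.norm_mkQ_sq_le
    {sol : EuclideanSpace ℝ (S × A) → EuclideanSpace ℝ (S × A)}
    (hsol : ∀ r, D.IsInteriorOptimum P r (sol r)) (hη : 0 < η) (hconv : D.StronglyConvex P η)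
    {R : Set (EuclideanSpace ℝ (S × A))} {σ : ℝ} (hσ : D.IsDualStrongConvexityConstant P R σ)
    {r r' : EuclideanSpace ℝ (S × A)} (hr : r ∈ R) (hr' : r' ∈ R) :
    ‖(D.shaping P).mkQ (r' - r)‖ ^ 2 ≤ 2 * D.SubOpt P r' (sol r) / σ := by
  have h1 := hσ.2 r hr r' hr'
  rw [(hasGradientAt_optValue hsol hη hconv r).gradient, ← map_sub,
    (hsol r).optValue_eq hη.le hconv, real_inner_comm] at h1
  rw [le_div_iff₀ hσ.1, SubOpt, J_eq_add_inner r]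
  linarith

end RegMDP

end IRL

end

/-! ### The transferability bound. -/

theorem theorem2 {S A : Type*} [Fintype S] [Fintype A] [Nontrivial S] [Nontrivial A]
    (D : IRL.RegMDP S A) (P₀ : IRL.TransitionLaw S A)
    (R : Set (EuclideanSpace ℝ (S × A))) (hR : IsCompact R)
    (η : ℝ) (hη : 0 < η)
    (hsteep : D.Steep) (hexp : D.Exploration P₀) (hreg : D.Regularity P₀ η) :
    (∃ σ : ℝ, D.IsDualStrongConvexityConstant P₀ R σ) ∧
    ∀ σ : ℝ, D.IsDualStrongConvexityConstant P₀ R σ →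
      ∀ rE ∈ R, ∀ μE ∈ D.RL P₀ rE, ∀ rhat ∈ R, ∀ εhat : ℝ,
        D.SubOpt P₀ rhat μE ≤ εhat →
        ∀ P : IRL.TransitionLaw S A, D.Exploration P → D.Regularity P η →
          D.IsTransferable rE rhat
            (2 * max (2 * εhat / σ) (Metric.diam R ^ 2 * Real.sin (D.θmax P₀ P) ^ 2) / η) {P} := by
  refine ⟨IRL.RegMDP.exists_isDualStrongConvexityConstant hsteep hexp hη hreg hR, ?_⟩
  rintro σ hσ rE hrE μE hμE rhat hrhat εhat hε _ hexpP hregP P rfl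
  choose sol₀ hsol₀ using D.exists_isInteriorOptimum hη.le hsteep hexp hreg.1
  choose sol hsol using D.exists_isInteriorOptimum hη.le hsteep hexpP hregP.1
  refine ⟨sol rhat, (hsol rhat).RL_eq hη hregP.1,
    ((hsol rhat).subOpt_le (hsol rE) hη hregP.1).trans ?_⟩
  rw [(hsol₀ rE).RL_eq hη hreg.1, Set.mem_singleton_iff] at hμE
  subst hμE
  have hb := hσ.norm_mkQ_sq_le hsol₀ hη hreg.1 hrE hrhat
  rw [map_sub, norm_sub_rev, ← map_sub] at hb
  have hb' : ‖(D.shaping P₀).mkQ (rE - rhat)‖ ^ 2 ≤ 2 * εhat / σ :=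
    hb.trans (div_le_div_of_nonneg_right (by linarith) hσ.1.le)
  have ha := IRL.norm_mkQ_le_add_sin_maxPrincipalAngle (D.shaping P₀) (D.shaping P)
    (by rw [D.finrank_shaping, D.finrank_shaping])
    (by rw [D.finrank_shaping]; exact Fintype.card_pos) (rE - rhat)
  have hdist : ‖rE - rhat‖ ≤ Metric.diam R := by
    rw [← dist_eq_norm]; exact Metric.dist_le_diam_of_mem hR.isBounded hrE hrhat
  change _ ≤ _ + |Real.sin (D.θmax P₀ P)| * _ at ha
  set a := ‖(D.shaping P).mkQ (rE - rhat)‖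
  set b := ‖(D.shaping P₀).mkQ (rE - rhat)‖
  set e := |Real.sin (D.θmax P₀ P)| * Metric.diam R with he
  have hae : a ≤ b + e :=
    ha.trans (add_le_add_right (mul_le_mul_of_nonneg_left hdist (abs_nonneg _)) b)
  have he2 : e ^ 2 = Metric.diam R ^ 2 * Real.sin (D.θmax P₀ P) ^ 2 := by
    rw [he, mul_pow, sq_abs]; ring
  rw [← he2]
  set M := max (2 * εhat / σ) (e ^ 2)
  have hbM : b ^ 2 ≤ M := hb'.trans (le_max_left _ _)
  have heM : e ^ 2 ≤ M := le_max_right _ _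
  -- `(b + e)² ≤ 2b² + 2e² ≤ 4M`; division by `2η` gives the stated `2M / η`.
  have haM : a ^ 2 ≤ 4 * M := by
    have h1 : a ^ 2 ≤ (b + e) ^ 2 := pow_le_pow_left₀ (norm_nonneg _) hae 2
    nlinarith [sq_nonneg (b - e)]
  rw [div_le_div_iff₀ (by positivity) hη]
  nlinarith
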